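/- Let $M$ be a complex manifold of complex dimension $2$ with a smooth Hermitian metric $g$ (no compactness is assumed). In local holomorphic coordinates let $$R_{i\bar jk\bar l}=-\frac{\partial^2 g_{k\bar l}}{\partial z^i\partial\bar z^j}+\sum_{p,q} g^{p\bar q}\frac{\partial g_{k\bar q}}{\partial z^i}\frac{\partial g_{p\bar l}}{\partial\bar z^j}$$ be the curvature of the Chern connection and let $Ric_{i\bar j}=\sum_{k,l} g^{k\bar l}R_{i\bar jk\bar l}$ be the first Chern Ricci curvature. Let $\alpha,\beta\in\mathbb{R}$ with $\beta\neq0$, and for a nonzero $(1,0)$-vector $X$ let $$\mathcal{C}_{\alpha,\beta}(X)=\frac{\alpha}{|X|^2}\,Ric(X,\bar X)+\beta\,\frac{R(X,\bar X,X,\bar X)}{|X|^4}$$ be the mixed curvature. Suppose that it is pointwise constant: there is a function $f:M\to\mathbb{R}$ with $\mathcal{C}_{\alpha,\beta}(X)=f(x)$ for every $x\in M$ and every nonzero $X\in T^{1,0}_xM$. Then $(M,g)$ is self-dual: the anti-self-dual part $W^-=\tfrac12(W-{\star}W)$ of the Weyl tensor $W$ of the underlying Riemannian metric (Levi-Civita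 connection), with respect to the orientation given by the complex structure, vanishes identically on $M$. -/

import Mathlib

open scoped Manifold ContDiff ComplexConjugate

noncomputable section

namespace HermitianSurface

/-- The model space `ℂ²` of a complex surface. -/
abbrev C2 : Type := Fin 2 → ℂ

/-! ### Hermitian metrics -/

section Metric

variable {M : Type*} [TopologicalSpace M] [ChartedSpace C2 M]

/-- The coordinate vector `∂/∂zⁱ` at the point `φ.symm z`, for the holomorphic chart `φ`. A vector of
the complex tangent space is identified with the corresponding `(1,0)`-vector. -/
def coordVec (φ : OpenPartialHomeomorph M C2) (z : C2) (i : Fin 2) :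
    TangentSpace 𝓘(ℂ, C2) (φ.symm z) :=
  mfderiv 𝓘(ℂ, C2) 𝓘(ℂ, C2) φ.symm z (Pi.single i (1 : ℂ) : C2)

end Metric

/-- A smooth Hermitian metric on a complex surface: a positive definite Hermitian form
`form x X Y = ⟨X, Ȳ⟩` on each tangent space, complex linear in `X` and conjugate linear in `Y`, whose
components `g_{i j̄}` in holomorphic charts are smooth (in the real sense). -/
structure HermitianMetric (M : Type*) [TopologicalSpace M] [ChartedSpace C2 M] where
  form : ∀ x : M, TangentSpace 𝓘(ℂ, C2) x →ₗ[ℂ] TangentSpace 𝓘(ℂ, C2) x →ₗ⋆[ℂ] ℂ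
  conj_symm : ∀ (x : M) (X Y : TangentSpace 𝓘(ℂ, C2) x), form x Y X = conj (form x X Y)
  pos : ∀ (x : M) (X : TangentSpace 𝓘(ℂ, C2) x), X ≠ 0 → 0 < (form x X X).re
  smooth : ∀ φ ∈ atlas C2 M, ∀ i j : Fin 2,
    ContDiffOn ℝ ∞ (fun z => form (φ.symm z) (coordVec φ z i) (coordVec φ z j)) φ.target

/-! ### Chern curvature in holomorphic coordinates

`G z i j` stands for `g_{i j̄}(z)`, a Hermitian matrix depending on `z` in an open subset of `ℂ²`. -/

/-- The Wirtinger derivative `∂F/∂zⁱ = ½ (∂F/∂xⁱ - √-1 ∂F/∂yⁱ)`. -/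
def dz (i : Fin 2) (F : C2 → ℂ) (z : C2) : ℂ :=
  (1 / 2) * (fderiv ℝ F z (Pi.single i 1) - Complex.I * fderiv ℝ F z (Pi.single i Complex.I))

/-- The Wirtinger derivative `∂F/∂z̄ⁱ = ½ (∂F/∂xⁱ + √-1 ∂F/∂yⁱ)`. -/
def dzbar (i : Fin 2) (F : C2 → ℂ) (z : C2) : ℂ :=
  (1 / 2) * (fderiv ℝ F z (Pi.single i 1) + Complex.I * fderiv ℝ F z (Pi.single i Complex.I))

/-- The inverse metric `g^{p q̄}`, normalised by `∑_q g^{p q̄} g_{k q̄} = δ_{pk}`. -/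
def invMetric (G : C2 → Matrix (Fin 2) (Fin 2) ℂ) (z : C2) (p q : Fin 2) : ℂ :=
  (G z)⁻¹ q p

/-- Components of the Chern curvature,
`R_{i j̄ k l̄} = - ∂²g_{k l̄}/∂zⁱ∂z̄ʲ + g^{p q̄} (∂g_{k q̄}/∂zⁱ) (∂g_{p l̄}/∂z̄ʲ)`. -/
def chernCoord (G : C2 → Matrix (Fin 2) (Fin 2) ℂ) (z : C2) (i j k l : Fin 2) : ℂ :=
  - dz i (dzbar j (fun w => G w k l)) z
    + ∑ p, ∑ q, invMetric G z p q * dz i (fun w => G w k q) z * dzbar j (fun w => G w p l) z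

/-- Components of the first Chern Ricci curvature, `R_{i j̄} = g^{k l̄} R_{i j̄ k l̄}`. -/
def chernRicciCoord (G : C2 → Matrix (Fin 2) (Fin 2) ℂ) (z : C2) (i j : Fin 2) : ℂ :=
  ∑ k, ∑ l, invMetric G z k l * chernCoord G z i j k l

/-! ### Riemannian geometry in the real coordinates `(x¹, y¹, x², y²)` of `ℂ²`

`g z a b` stands for the components of a Riemannian metric. -/

/-- The real basis `∂/∂x¹, ∂/∂y¹, ∂/∂x², ∂/∂y²`; it is positively oriented. -/
def realBasis : Fin 4 → C2 :=
  ![![1, 0], ![Complex.I, 0], ![0, 1], ![0, Complex.I]]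

/-- The components of a vector of `ℂ²` with respect to `realBasis`. -/
def realCoord (v : C2) : Fin 4 → ℝ :=
  ![(v 0).re, (v 0).im, (v 1).re, (v 1).im]

/-- The real partial derivative in the direction of the `a`-th real coordinate. -/
def dR (a : Fin 4) (F : C2 → ℝ) (z : C2) : ℝ :=
  fderiv ℝ F z (realBasis a)

/-- The Riemannian metric underlying a Hermitian metric, `2 Re (g_{i j̄} dzⁱ dz̄ʲ)`; that is, the real
metric whose complex bilinear extension takes the value `g_{i j̄}` on `(∂/∂zⁱ, ∂/∂z̄ʲ)`. -/
def realMetric (G : C2 → Matrix (Fin 2) (Fin 2) ℂ) (z : C2) : Matrix (Fin 4) (Fin 4) ℝ :=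
  fun a b => 2 * (∑ i, ∑ j, G z i j * realBasis a i * conj (realBasis b j)).re

/-- Christoffel symbols `Γ^c_{ab}` of the Levi-Civita connection. -/
def christoffel (g : C2 → Matrix (Fin 4) (Fin 4) ℝ) (c a b : Fin 4) (z : C2) : ℝ :=
  (1 / 2) * ∑ d, (g z)⁻¹ c d *
    (dR a (fun w => g w d b) z + dR b (fun w => g w d a) z - dR d (fun w => g w a b) z)

/-- The Riemann tensor `R^d_{cab}`: the `∂_d`-component of `R(∂_a, ∂_b) ∂_c`, where
`R(X, Y) = [∇_X, ∇_Y] - ∇_{[X, Y]}`. -/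
def riemannUp (g : C2 → Matrix (Fin 4) (Fin 4) ℝ) (z : C2) (d c a b : Fin 4) : ℝ :=
  dR a (christoffel g d b c) z - dR b (christoffel g d a c) z
    + ∑ e, (christoffel g d a e z * christoffel g e b c z
      - christoffel g d b e z * christoffel g e a c z)

/-- The Riemann tensor with lowered index, `R_{dcab}`. -/
def riemann (g : C2 → Matrix (Fin 4) (Fin 4) ℝ) (z : C2) (d c a b : Fin 4) : ℝ :=
  ∑ e, g z d e * riemannUp g z e c a b

/-- The Ricci tensor of the Levi-Civita connection. -/
def ricci (g : C2 → Matrix (Fin 4) (Fin 4) ℝ) (z : C2) (c b : Fin 4) : ℝ :=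
  ∑ a, riemannUp g z a c a b

/-- The Riemannian scalar curvature. -/
def scalar (g : C2 → Matrix (Fin 4) (Fin 4) ℝ) (z : C2) : ℝ :=
  ∑ a, ∑ b, (g z)⁻¹ a b * ricci g z a b

/-- The Weyl tensor `W_{abcd}` of a four-dimensional Riemannian metric. -/
def weyl (g : C2 → Matrix (Fin 4) (Fin 4) ℝ) (z : C2) (a b c d : Fin 4) : ℝ :=
  riemann g z a b c d
    - (1 / 2) * (g z a c * ricci g z b d - g z a d * ricci g z b c
      - g z b c * ricci g z a d + g z b d * ricci g z a c)
    + (scalar g z / 6) * (g z a c * g z b d - g z a d * g z b c)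

/-- The Levi-Civita symbol on four letters, with value `1` on `(0, 1, 2, 3)`. -/
def levi (a b c d : Fin 4) : ℝ :=
  Matrix.det (Matrix.of fun i j : Fin 4 => if ![a, b, c, d] i = j then (1 : ℝ) else 0)

/-- The Hodge star operator on 2-forms, `(⋆η)_{ab} = ½ √(det g) ε_{abef} g^{ep} g^{fq} η_{pq}`, for the
orientation `dx¹ ∧ dy¹ ∧ dx² ∧ dy²` given by the complex structure. -/
def hodgeStar (g : C2 → Matrix (Fin 4) (Fin 4) ℝ) (z : C2) (η : Fin 4 → Fin 4 → ℝ) (a b : Fin 4) : ℝ :=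
  (1 / 2) * Real.sqrt (g z).det *
    ∑ e, ∑ f, ∑ p, ∑ q, levi a b e f * (g z)⁻¹ e p * (g z)⁻¹ f q * η p q

/-- The anti-self-dual part `W⁻ = ½ (W - ⋆W)` of the Weyl tensor, regarded as a 2-form with values in
2-forms. -/
def weylMinusCoord (g : C2 → Matrix (Fin 4) (Fin 4) ℝ) (z : C2) (a b c d : Fin 4) : ℝ :=
  (1 / 2) * (weyl g z a b c d - hodgeStar g z (fun p q => weyl g z p q c d) a b)

/-! ### The tensors of a Hermitian surface

Each of these tensors is evaluated in the preferred holomorphic chart at the point; the coordinate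
expressions being tensorial, every other holomorphic chart gives the same values. -/

namespace HermitianMetric

variable {M : Type*} [TopologicalSpace M] [ChartedSpace C2 M] (g : HermitianMetric M)

/-- The components `g_{i j̄} = ⟨∂/∂zⁱ, ∂/∂z̄ʲ⟩` in the chart `φ`. -/
def coeff (φ : OpenPartialHomeomorph M C2) (z : C2) : Matrix (Fin 2) (Fin 2) ℂ :=
  fun i j => g.form (φ.symm z) (coordVec φ z i) (coordVec φ z j)

/-- The components `Xⁱ` of a tangent vector at `x` in the preferred chart at `x`. -/
def comp (x : M) (X : TangentSpace 𝓘(ℂ, C2) x) : C2 :=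
  mfderiv 𝓘(ℂ, C2) 𝓘(ℂ, C2) (chartAt C2 x) x X

/-- The Chern curvature `R(X, Ȳ, Z, V̄)`. -/
def chern (x : M) (X Y Z V : TangentSpace 𝓘(ℂ, C2) x) : ℂ :=
  ∑ i, ∑ j, ∑ k, ∑ l, chernCoord (g.coeff (chartAt C2 x)) (chartAt C2 x x) i j k l
    * comp x X i * conj (comp x Y j) * comp x Z k * conj (comp x V l)

/-- The first Chern Ricci curvature `Ric(X, Ȳ)`. -/
def chernRicci (x : M) (X Y : TangentSpace 𝓘(ℂ, C2) x) : ℂ :=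
  ∑ i, ∑ j, chernRicciCoord (g.coeff (chartAt C2 x)) (chartAt C2 x x) i j
    * comp x X i * conj (comp x Y j)

/-- The holomorphic sectional curvature `H(X) = R(X, X̄, X, X̄) / |X|⁴`. -/
def holSec (x : M) (X : TangentSpace 𝓘(ℂ, C2) x) : ℂ :=
  g.chern x X X X X / g.form x X X ^ 2

/-- The mixed curvature `C_{α,β}(X) = α Ric(X, X̄) / |X|² + β H(X)`. -/
def mixedCurvature (α β : ℝ) (x : M) (X : TangentSpace 𝓘(ℂ, C2) x) : ℂ :=
  α / g.form x X X * g.chernRicci x X X + β * g.holSec x X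

/-- The anti-self-dual part `W⁻` of the Weyl tensor of the underlying Riemannian metric, with respect
to the orientation given by the complex structure. -/
def weylMinus (x : M) (v₁ v₂ v₃ v₄ : TangentSpace 𝓘(ℂ, C2) x) : ℝ :=
  ∑ a, ∑ b, ∑ c, ∑ d,
    weylMinusCoord (realMetric (g.coeff (chartAt C2 x))) (chartAt C2 x x) a b c d
      * realCoord (comp x v₁) a * realCoord (comp x v₂) b
      * realCoord (comp x v₃) c * realCoord (comp x v₄) d

/-- A Hermitian surface is self-dual if `W⁻ = 0`. -/
def IsSelfDual : Prop :=
  ∀ (x : M) (v₁ v₂ v₃ v₄ : TangentSpace 𝓘(ℂ, C2) x), g.weylMinus x v₁ v₂ v₃ v₄ = 0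

end HermitianMetric

end HermitianSurface

end

/-! The hypothesis says that a form of bidegree (2,2) in `X` vanishes identically: α⟨X,X̄⟩Ric(X,X̄)
+ βR(X,X̄,X,X̄) − f⟨X,X̄⟩² = 0. Its coefficients, symmetrized in the two holomorphic and the two
antiholomorphic slots, are therefore zero, so `X̄` may be replaced by an independent vector `Y`
(`polarization`). On pairs with ⟨X,Y⟩ = 0 the Ricci term and the `f` term carry a factor ⟨X,Y⟩ and
drop out; as β ≠ 0, the Chern curvature R(X,Y,X,Y) vanishes there (`chernForm_eq_zero`).

For such a pair the plane spanned by the (1,0)-vector `X` and the (0,1)-vector `Y` is totally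
isotropic. Although the metric need not be Kähler, the Levi-Civita curvature on this plane is minus
the Chern curvature: the only extra term is a contraction of mixed Christoffel symbols, which
vanishes in complex dimension two (`ev4_riemann_eq_chern`, `sum_null_eq_zero`). The Riemann and Weyl
tensors also agree on an isotropic plane, because their difference is a Kulkarni–Nomizu product with
the metric (`ev4_weyl`). Hence the Weyl tensor vanishes on all these bivectors.

The bivectors `X ∧ Y` with ⟨X,Y⟩ = 0 form the null cone of the complexified space Λ⁻, which has
dimension three. A quadratic form vanishing on this cone is a multiple of the metric of Λ⁻, and W⁻
is trace-free, so the multiple is zero (`weyl_frame`, `weyl_null_frame`). What remains of each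
2-form W(·,·,c,d) is a multiple of the fundamental form plus a part of type (2,0)+(0,2), which is
self-dual (`hodgeStar_eq`). -/

open scoped Topology

noncomputable section

namespace HermitianSurface

/-! ### The Riemann tensor with lowered indices -/

section Riemann

variable {g : C2 → Matrix (Fin 4) (Fin 4) ℝ} {z : C2}

/-- Christoffel symbols of the first kind, `Γ_{d,bc}`. -/
def chrLow (g : C2 → Matrix (Fin 4) (Fin 4) ℝ) (d b c : Fin 4) (z : C2) : ℝ :=
  (1 / 2) * (dR b (fun w => g w d c) z + dR c (fun w => g w d b) z - dR d (fun w => g w b c) z)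

theorem christoffel_eq (c a b : Fin 4) (w : C2) :
    christoffel g c a b w = ∑ d, (g w)⁻¹ c d * chrLow g d a b w := by
  simp only [christoffel, chrLow, Finset.mul_sum]
  exact Finset.sum_congr rfl fun d _ => by ring

theorem differentiableAt_det {n : ℕ} {A : C2 → Matrix (Fin n) (Fin n) ℝ}
    (hA : ∀ a b, DifferentiableAt ℝ (fun w => A w a b) z) :
    DifferentiableAt ℝ (fun w => (A w).det) z := by
  simp only [Matrix.det_apply]
  refine DifferentiableAt.fun_sum fun σ _ => ?_
  refine DifferentiableAt.const_smul ?_ _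
  simpa only [Finset.prod_fn] using (HasFDerivAt.finsetProd (u := Finset.univ)
    (g := fun i w => A w (σ i) i) fun i _ => (hA (σ i) i).hasFDerivAt).differentiableAt

theorem differentiableAt_inv (hg : ∀ a b, DifferentiableAt ℝ (fun w => g w a b) z)
    (hdet : (g z).det ≠ 0) (a b : Fin 4) :
    DifferentiableAt ℝ (fun w => (g w)⁻¹ a b) z := by
  simp only [Matrix.inv_def, Ring.inverse_eq_inv', Matrix.smul_apply, smul_eq_mul,
    Matrix.adjugate_apply]
  refine ((differentiableAt_det hg).inv hdet).mul (differentiableAt_det fun i j => ?_)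
  by_cases h : i = b
  · simp [Matrix.updateRow_apply, h]
  · simpa [Matrix.updateRow_apply, h] using hg i j

theorem differentiableAt_dR {F : C2 → ℝ} (hF : ContDiffAt ℝ 2 F z) (a : Fin 4) :
    DifferentiableAt ℝ (dR a F) z := by
  have h : ContDiffAt ℝ 1 (fderiv ℝ F) z := hF.fderiv_right (by norm_num)
  exact (h.differentiableAt (by norm_num)).clm_apply (differentiableAt_const _)

theorem dR_dR_comm {F : C2 → ℝ} (hF : ContDiffAt ℝ 2 F z) (a b : Fin 4) :
    dR a (dR b F) z = dR b (dR a F) z := by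
  have h : DifferentiableAt ℝ (fderiv ℝ F) z :=
    (hF.fderiv_right (m := 1) (by norm_num)).differentiableAt (by norm_num)
  have key : ∀ a b, dR a (dR b F) z = fderiv ℝ (fderiv ℝ F) z (realBasis a) (realBasis b) := by
    intro a b
    have := (h.hasFDerivAt.clm_apply (hasFDerivAt_const (realBasis b) z)).fderiv
    change fderiv ℝ (fun w => fderiv ℝ F w (realBasis b)) z (realBasis a) = _
    rw [this]; simp
  rw [key, key]
  exact (hF.isSymmSndFDerivAt (by simp)).eq _ _

theorem differentiableAt_chrLow (hg : ∀ a b, ContDiffAt ℝ 2 (fun w => g w a b) z)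
    (d b c : Fin 4) : DifferentiableAt ℝ (chrLow g d b c) z :=
  (((differentiableAt_dR (hg d c) b).add (differentiableAt_dR (hg d b) c)).sub
    (differentiableAt_dR (hg b c) d)).const_mul _

theorem dR_chrLow (hg : ∀ a b, ContDiffAt ℝ 2 (fun w => g w a b) z) (a d b c : Fin 4) :
    dR a (chrLow g d b c) z = (1 / 2) * (dR a (dR b (fun w => g w d c)) z
      + dR a (dR c (fun w => g w d b)) z - dR a (dR d (fun w => g w b c)) z) := by
  have := ((((differentiableAt_dR (hg d c) b).hasFDerivAt.add
    (differentiableAt_dR (hg d b) c).hasFDerivAt).sub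
    (differentiableAt_dR (hg b c) d).hasFDerivAt).const_mul (1 / 2 : ℝ)).fderiv
  change fderiv ℝ _ z _ = _
  erw [this]
  simp [dR]

theorem differentiableAt_christoffel (hg : ∀ a b, ContDiffAt ℝ 2 (fun w => g w a b) z)
    (hdet : (g z).det ≠ 0) (c a b : Fin 4) : DifferentiableAt ℝ (christoffel g c a b) z := by
  have : christoffel g c a b = fun w => ∑ d, (g w)⁻¹ c d * chrLow g d a b w :=
    funext fun w => christoffel_eq c a b w
  rw [this]
  exact DifferentiableAt.fun_sum fun d _ => (differentiableAt_inv
    (fun i j => (hg i j).differentiableAt (by norm_num)) hdet c d).mul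
    (differentiableAt_chrLow hg d a b)

theorem sum_mul_christoffel {w : C2} (hdet : (g w).det ≠ 0) (d b c : Fin 4) :
    ∑ e, g w d e * christoffel g e b c w = chrLow g d b c w := by
  have h : g w * (g w)⁻¹ = 1 := Matrix.mul_nonsing_inv _ (isUnit_iff_ne_zero.2 hdet)
  have h2 : (g w).mulVec ((g w)⁻¹.mulVec fun e => chrLow g e b c w) d = chrLow g d b c w := by
    rw [Matrix.mulVec_mulVec, h, Matrix.one_mulVec]
  rw [← h2]
  simp only [christoffel_eq]
  rfl

/-- Product rule applied to g_{de}Γ^e_{bc} = Γ_{d,bc} on a neighbourhood of `z`. This keeps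
derivatives of the inverse metric out of the curvature formula. -/
theorem sum_mul_dR_christoffel (hg : ∀ a b, ContDiffAt ℝ 2 (fun w => g w a b) z)
    (hdet : (g z).det ≠ 0) (a d b c : Fin 4) :
    ∑ e, g z d e * dR a (christoffel g e b c) z =
      dR a (chrLow g d b c) z - ∑ e, dR a (fun w => g w d e) z * christoffel g e b c z := by
  have hg1 : ∀ i j, DifferentiableAt ℝ (fun w => g w i j) z :=
    fun i j => (hg i j).differentiableAt (by norm_num)
  have hev : ∀ᶠ w in 𝓝 z, (g w).det ≠ 0 :=
    (differentiableAt_det hg1).continuousAt.eventually_ne hdet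
  have hE : (fun w => ∑ e, g w d e * christoffel g e b c w) =ᶠ[𝓝 z] chrLow g d b c := by
    filter_upwards [hev] with w hw using sum_mul_christoffel hw d b c
  have h1 : dR a (chrLow g d b c) z = dR a (fun w => ∑ e, g w d e * christoffel g e b c w) z := by
    simp only [dR, hE.fderiv_eq]
  have h2 := (HasFDerivAt.fun_sum (u := Finset.univ) fun (e : Fin 4) _ =>
    (hg1 d e).hasFDerivAt.mul (differentiableAt_christoffel hg hdet e b c).hasFDerivAt).fderiv
  rw [h1, eq_sub_iff_add_eq, ← Finset.sum_add_distrib]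
  conv_rhs => simp only [dR]
  erw [h2]
  simp only [sum_apply, add_apply,
    smul_apply, smul_eq_mul, dR]
  exact Finset.sum_congr rfl fun e _ => by ring

theorem chrLow_comm (hs : ∀ᶠ w in 𝓝 z, ∀ a b, g w a b = g w b a) (d b c : Fin 4) :
    chrLow g d b c z = chrLow g d c b z := by
  have h : (fun w => g w b c) =ᶠ[𝓝 z] fun w => g w c b := by
    filter_upwards [hs] with w hw using hw b c
  simp only [chrLow, dR, h.fderiv_eq]
  ring

/-- Compatibility of the Levi-Civita connection with the metric. -/
theorem dR_metric (hs : ∀ᶠ w in 𝓝 z, ∀ a b, g w a b = g w b a) (a d e : Fin 4) :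
    dR a (fun w => g w d e) z = chrLow g d a e z + chrLow g e a d z := by
  have h' : ∀ x b c, dR x (fun w => g w b c) z = dR x (fun w => g w c b) z := fun x b c => by
    have h : (fun w => g w b c) =ᶠ[𝓝 z] fun w => g w c b := by
      filter_upwards [hs] with w hw using hw b c
    simp only [dR, h.fderiv_eq]
  simp only [chrLow]
  rw [h' a e d, h' d a e, h' e a d]
  ring

/-- Lowering the index produces −(∂_a g_{de})Γ^e_{bc}. By `dR_metric` this splits into two terms:
one cancels the quadratic term of `riemannUp`, the other gives the contraction of two lowered
symbols. -/
theorem riemann_eq (hg : ∀ a b, ContDiffAt ℝ 2 (fun w => g w a b) z)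
    (hs : ∀ᶠ w in 𝓝 z, ∀ a b, g w a b = g w b a)
    (hdet : (g z).det ≠ 0) (d c a b : Fin 4) :
    riemann g z d c a b = dR a (chrLow g d b c) z - dR b (chrLow g d a c) z
      - ∑ e, ∑ f, (g z)⁻¹ e f * (chrLow g e a d z * chrLow g f b c z)
      + ∑ e, ∑ f, (g z)⁻¹ e f * (chrLow g e b d z * chrLow g f a c z) := by
  have h1 : ∀ a b, ∑ e, chrLow g e a d z * christoffel g e b c z
      = ∑ e, ∑ f, (g z)⁻¹ e f * (chrLow g e a d z * chrLow g f b c z) := fun a b => by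
    refine Finset.sum_congr rfl fun e _ => ?_
    rw [christoffel_eq, Finset.mul_sum]
    exact Finset.sum_congr rfl fun f _ => by ring
  have h2 : ∀ a b, ∑ e, g z d e * ∑ f, christoffel g e a f z * christoffel g f b c z
      = ∑ f, chrLow g d a f z * christoffel g f b c z := fun a b => by
    simp only [Finset.mul_sum]
    rw [Finset.sum_comm]
    refine Finset.sum_congr rfl fun f _ => ?_
    rw [← sum_mul_christoffel hdet, Finset.sum_mul]
    exact Finset.sum_congr rfl fun e _ => by ring
  simp only [riemann, riemannUp, mul_add, mul_sub, Finset.sum_add_distrib, Finset.sum_sub_distrib]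
  rw [sum_mul_dR_christoffel hg hdet, sum_mul_dR_christoffel hg hdet, h2, h2, ← h1, ← h1]
  simp only [dR_metric hs, add_mul, Finset.sum_add_distrib]
  ring

end Riemann

/-! ### Complex multilinear extension of tensors -/

section Extension

/-- The complex bilinear extension of a 2-tensor. -/
def ev2 (T : Fin 4 → Fin 4 → ℝ) (u v : Fin 4 → ℂ) : ℂ :=
  ∑ a, ∑ b, (T a b : ℂ) * u a * v b

/-- The complex multilinear extension of a 4-tensor. -/
def ev4 (T : Fin 4 → Fin 4 → Fin 4 → Fin 4 → ℝ) (u v x y : Fin 4 → ℂ) : ℂ :=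
  ∑ a, ∑ b, ∑ c, ∑ d, (T a b c d : ℂ) * u a * v b * x c * y d

variable (T S : Fin 4 → Fin 4 → Fin 4 → Fin 4 → ℝ) (P Q : Fin 4 → Fin 4 → ℝ)
  (u u' v v' x x' y y' : Fin 4 → ℂ) (t : ℂ)

theorem ev4_add₁ : ev4 T (u + u') v x y = ev4 T u v x y + ev4 T u' v x y := by
  simp only [ev4, Pi.add_apply, mul_add, add_mul, Finset.sum_add_distrib]

theorem ev4_add₂ : ev4 T u (v + v') x y = ev4 T u v x y + ev4 T u v' x y := by
  simp only [ev4, Pi.add_apply, mul_add, add_mul, Finset.sum_add_distrib]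

theorem ev4_add₃ : ev4 T u v (x + x') y = ev4 T u v x y + ev4 T u v x' y := by
  simp only [ev4, Pi.add_apply, mul_add, add_mul, Finset.sum_add_distrib]

theorem ev4_add₄ : ev4 T u v x (y + y') = ev4 T u v x y + ev4 T u v x y' := by
  simp only [ev4, Pi.add_apply, mul_add, Finset.sum_add_distrib]

theorem ev4_smul₁ : ev4 T (t • u) v x y = t * ev4 T u v x y := by
  simp only [ev4, Pi.smul_apply, smul_eq_mul, Finset.mul_sum]
  exact Finset.sum_congr rfl fun _ _ => Finset.sum_congr rfl fun _ _ =>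
    Finset.sum_congr rfl fun _ _ => Finset.sum_congr rfl fun _ _ => by ring

theorem ev4_smul₂ : ev4 T u (t • v) x y = t * ev4 T u v x y := by
  simp only [ev4, Pi.smul_apply, smul_eq_mul, Finset.mul_sum]
  exact Finset.sum_congr rfl fun _ _ => Finset.sum_congr rfl fun _ _ =>
    Finset.sum_congr rfl fun _ _ => Finset.sum_congr rfl fun _ _ => by ring

theorem ev4_smul₃ : ev4 T u v (t • x) y = t * ev4 T u v x y := by
  simp only [ev4, Pi.smul_apply, smul_eq_mul, Finset.mul_sum]
  exact Finset.sum_congr rfl fun _ _ => Finset.sum_congr rfl fun _ _ =>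
    Finset.sum_congr rfl fun _ _ => Finset.sum_congr rfl fun _ _ => by ring

theorem ev4_smul₄ : ev4 T u v x (t • y) = t * ev4 T u v x y := by
  simp only [ev4, Pi.smul_apply, smul_eq_mul, Finset.mul_sum]
  exact Finset.sum_congr rfl fun _ _ => Finset.sum_congr rfl fun _ _ =>
    Finset.sum_congr rfl fun _ _ => Finset.sum_congr rfl fun _ _ => by ring

theorem ev4_add_tensor :
    ev4 (fun a b c d => T a b c d + S a b c d) u v x y = ev4 T u v x y + ev4 S u v x y := by
  simp only [ev4, Complex.ofReal_add, add_mul, Finset.sum_add_distrib]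

theorem ev4_sub_tensor :
    ev4 (fun a b c d => T a b c d - S a b c d) u v x y = ev4 T u v x y - ev4 S u v x y := by
  simp only [ev4, Complex.ofReal_sub, sub_mul, Finset.sum_sub_distrib]

theorem ev4_neg_tensor : ev4 (fun a b c d => - T a b c d) u v x y = - ev4 T u v x y := by
  simp only [ev4, Complex.ofReal_neg, neg_mul, Finset.sum_neg_distrib]

theorem ev4_mul_tensor (r : ℝ) : ev4 (fun a b c d => r * T a b c d) u v x y = r * ev4 T u v x y := by
  simp only [ev4, Complex.ofReal_mul, mul_assoc, Finset.mul_sum]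

theorem ev4_swap₁₂ : ev4 (fun a b c d => T b a c d) u v x y = ev4 T v u x y := by
  rw [ev4, Finset.sum_comm]
  exact Finset.sum_congr rfl fun _ _ => Finset.sum_congr rfl fun _ _ =>
    Finset.sum_congr rfl fun _ _ => Finset.sum_congr rfl fun _ _ => by ring

theorem ev4_swap₂₃ : ev4 (fun a b c d => T a c b d) u v x y = ev4 T u x v y := by
  refine Finset.sum_congr rfl fun _ _ => ?_
  rw [Finset.sum_comm]
  exact Finset.sum_congr rfl fun _ _ =>
    Finset.sum_congr rfl fun _ _ => Finset.sum_congr rfl fun _ _ => by ring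

theorem ev4_swap₃₄ : ev4 (fun a b c d => T a b d c) u v x y = ev4 T u v y x := by
  refine Finset.sum_congr rfl fun _ _ => Finset.sum_congr rfl fun _ _ => ?_
  rw [Finset.sum_comm]
  exact Finset.sum_congr rfl fun _ _ => Finset.sum_congr rfl fun _ _ => by ring

theorem ev4_prod : ev4 (fun a b c d => P a b * Q c d) u v x y = ev2 P u v * ev2 Q x y := by
  simp only [ev4, ev2, Finset.sum_mul]
  simp only [Finset.mul_sum, Complex.ofReal_mul]
  exact Finset.sum_congr rfl fun _ _ => Finset.sum_congr rfl fun _ _ =>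
    Finset.sum_congr rfl fun _ _ => Finset.sum_congr rfl fun _ _ => by ring

end Extension

/-! ### Algebraic Weyl tensors -/

/-- A Weyl tensor in four dimensions, in a complex basis `f₀, f₁, f₂, f₃` with
`⟨f₀, f₂⟩ = ⟨f₁, f₃⟩ = 1` and all other products `0`, vanishes on the bivectors
`f₀ ∧ f₃`, `f₁ ∧ f₂` and `f₀ ∧ f₂ - f₁ ∧ f₃` as soon as its quadratic form vanishes on the null
bivectors in their span. -/
theorem weyl_frame {w : Fin 4 → Fin 4 → Fin 4 → Fin 4 → ℂ}
    (h12 : ∀ a b c d, w b a c d = - w a b c d)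
    (hp : ∀ a b c d, w c d a b = w a b c d)
    (hb : ∀ a b c d, w a b c d + w a c d b + w a d b c = 0)
    (ht : ∀ b d, w 0 b 2 d + w 2 b 0 d + (w 1 b 3 d + w 3 b 1 d) = 0)
    (h4 : w 0 3 0 3 = 0) (h0 : w 1 2 1 2 = 0)
    (h3 : w 0 3 0 2 = w 0 3 1 3) (h1 : w 1 2 0 2 = w 1 2 1 3)
    (h2 : w 0 2 0 2 + w 1 3 1 3 - 2 * w 0 2 1 3 = 2 * w 0 3 1 2) (c d : Fin 4) :
    w 0 3 c d = 0 ∧ w 1 2 c d = 0 ∧ w 0 2 c d = w 1 3 c d := by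
  have h34 : ∀ a b c d, w a b d c = - w a b c d := fun a b c d => by
    rw [← hp, h12, hp]
  have aa : ∀ a c d, w a a c d = 0 := fun a c d => by
    have := h12 a a c d; linear_combination (1/2) * this
  have cc : ∀ a b c, w a b c c = 0 := fun a b c => by rw [← hp, aa]
  -- `e1`–`e4` are the trace condition `ht` with equal indices.
  have e1 : w 0 3 0 1 = 0 := by grind
  have e2 : w 0 3 2 3 = 0 := by grind
  have e3 : w 1 2 0 1 = 0 := by grind
  have e4 : w 1 2 2 3 = 0 := by grind
  -- The trace condition gives w₀₃₀₂ = −w₀₃₁₃, whereas `h3` gives equality; `e6` is analogous.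
  have e5 : w 0 3 0 2 = 0 := by grind
  have e6 : w 1 2 0 2 = 0 := by grind
  -- The traces give w₀₂₀₂ = w₁₃₁₃ = w₀₁₂₃ − w₀₃₁₂ and the Bianchi identity gives w₀₂₁₃ = w₀₁₂₃ +
  -- w₀₃₁₂. The left side of `h2` is thus −4w₀₃₁₂, its right side 2w₀₃₁₂. This is where
  -- trace-freeness excludes a multiple of the metric of Λ⁻.
  have e7 : w 0 3 1 2 = 0 := by grind
  have e8 : w 0 2 0 2 = w 1 3 1 3 := by grind
  have e9 : w 0 2 1 3 = w 1 3 1 3 := by grind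
  have e10 : w 0 2 0 1 = w 1 3 0 1 := by grind
  have e11 : w 0 2 2 3 = w 1 3 2 3 := by grind
  fin_cases c <;> fin_cases d <;>
    simp only [Fin.zero_eta, Fin.mk_one, Fin.reduceFinMk] <;> grind

/-! ### Complex frames -/

/-- The complex bilinear extension of a metric. -/
def bil (h : Matrix (Fin 4) (Fin 4) ℝ) (u v : Fin 4 → ℂ) : ℂ :=
  ∑ a, ∑ b, (h a b : ℂ) * u a * v b

theorem bil_add_left (T : Matrix (Fin 4) (Fin 4) ℝ) (u u' v : Fin 4 → ℂ) :
    bil T (u + u') v = bil T u v + bil T u' v := by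
  simp only [bil, Pi.add_apply, mul_add, add_mul, Finset.sum_add_distrib]

theorem bil_add_right (T : Matrix (Fin 4) (Fin 4) ℝ) (u v v' : Fin 4 → ℂ) :
    bil T u (v + v') = bil T u v + bil T u v' := by
  simp only [bil, Pi.add_apply, mul_add, Finset.sum_add_distrib]

theorem bil_smul_left (T : Matrix (Fin 4) (Fin 4) ℝ) (t : ℂ) (u v : Fin 4 → ℂ) :
    bil T (t • u) v = t * bil T u v := by
  simp only [bil, Pi.smul_apply, smul_eq_mul, Finset.mul_sum]
  exact Finset.sum_congr rfl fun _ _ => Finset.sum_congr rfl fun _ _ => by ring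

theorem bil_smul_right (T : Matrix (Fin 4) (Fin 4) ℝ) (t : ℂ) (u v : Fin 4 → ℂ) :
    bil T u (t • v) = t * bil T u v := by
  simp only [bil, Pi.smul_apply, smul_eq_mul, Finset.mul_sum]
  exact Finset.sum_congr rfl fun _ _ => Finset.sum_congr rfl fun _ _ => by ring

section Frame

variable {h : Matrix (Fin 4) (Fin 4) ℝ} {F : Fin 4 → Fin 4 → ℂ} {N K : Matrix (Fin 4) (Fin 4) ℂ}

theorem sum_frame (B : Matrix (Fin 4) (Fin 4) ℂ) (F : Fin 4 → Fin 4 → ℂ) (C D : Fin 4) :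
    (Matrix.of F * B * (Matrix.of F).transpose) C D = ∑ c, ∑ d, B c d * F C c * F D d := by
  simp only [Matrix.mul_apply, Matrix.transpose_apply, Matrix.of_apply, Finset.sum_mul]
  rw [Finset.sum_comm]
  exact Finset.sum_congr rfl fun _ _ => Finset.sum_congr rfl fun _ _ => by ring

theorem frame_mul (hF : ∀ A B, bil h (F A) (F B) = N A B) :
    Matrix.of F * h.map Complex.ofReal * (Matrix.of F).transpose = N := by
  ext A B
  rw [sum_frame, ← hF A B]
  rfl

/-- The inverse of a metric with components `N` in a complex frame. -/
theorem inv_eq_frame (hF : ∀ A B, bil h (F A) (F B) = N A B) (hK : N * K = 1) (a b : Fin 4) :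
    ((h⁻¹ a b : ℝ) : ℂ) = ∑ A, ∑ B, K A B * F A a * F B b := by
  have h1 : Matrix.of F * (h.map Complex.ofReal * ((Matrix.of F).transpose * K)) = 1 := by
    rw [← Matrix.mul_assoc, ← Matrix.mul_assoc, frame_mul hF, hK]
  have h2 : h.map Complex.ofReal * ((Matrix.of F).transpose * K * Matrix.of F) = 1 := by
    rw [← Matrix.mul_assoc]
    exact mul_eq_one_comm.1 h1
  have h3 : IsUnit h.det := by
    have : IsUnit ((h.map Complex.ofReal).det) := Matrix.isUnit_det_of_right_inverse h2
    rw [show h.map Complex.ofReal = Complex.ofRealHom.mapMatrix h from rfl,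
      ← RingHom.map_det] at this
    rw [isUnit_iff_ne_zero] at this ⊢
    intro h0
    exact this (by rw [h0]; simp)
  have h4 : h.map Complex.ofReal * (h⁻¹).map Complex.ofReal = 1 := by
    have := congrArg (Complex.ofRealHom.mapMatrix) (Matrix.mul_nonsing_inv h h3)
    rwa [map_mul, map_one] at this
  have h5 : (h⁻¹).map Complex.ofReal = (Matrix.of F).transpose * K * Matrix.of F := by
    rw [← Matrix.inv_eq_right_inv h4, Matrix.inv_eq_right_inv h2]
  have h6 := congrFun (congrFun h5 a) b
  rw [Matrix.map_apply] at h6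
  rw [h6, Matrix.mul_assoc]
  simp only [Matrix.mul_apply, Matrix.transpose_apply, Matrix.of_apply, Finset.mul_sum]
  exact Finset.sum_congr rfl fun _ _ => Finset.sum_congr rfl fun _ _ => by ring

/-- A bilinear form vanishing on a frame vanishes. -/
theorem eq_zero_of_frame (hF : ∀ A B, bil h (F A) (F B) = N A B) (hK : N * K = 1)
    {B : Matrix (Fin 4) (Fin 4) ℂ} (hB : ∀ C D, ∑ c, ∑ d, B c d * F C c * F D d = 0) : B = 0 := by
  have h1 : Matrix.of F * (h.map Complex.ofReal * ((Matrix.of F).transpose * K)) = 1 := by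
    rw [← Matrix.mul_assoc, ← Matrix.mul_assoc, frame_mul hF, hK]
  have hu : IsUnit (Matrix.of F).det := Matrix.isUnit_det_of_right_inverse h1
  have hu' : IsUnit (Matrix.of F).transpose.det := by rwa [Matrix.det_transpose]
  have hB' : Matrix.of F * B * (Matrix.of F).transpose = 0 := by
    ext C D
    rw [sum_frame]
    exact hB C D
  calc B = ((Matrix.of F)⁻¹ * (Matrix.of F)) * B * ((Matrix.of F).transpose *
        ((Matrix.of F).transpose)⁻¹) := by
        rw [Matrix.nonsing_inv_mul _ hu, Matrix.mul_nonsing_inv _ hu', Matrix.one_mul,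
          Matrix.mul_one]
    _ = (Matrix.of F)⁻¹ * (Matrix.of F * B * (Matrix.of F).transpose) *
        ((Matrix.of F).transpose)⁻¹ := by simp only [Matrix.mul_assoc]
    _ = 0 := by rw [hB']; simp

end Frame

/-! ### The Weyl tensor -/

section Weyl

/-- The algebraic symmetries of a curvature tensor. -/
structure IsCurvature (R : Fin 4 → Fin 4 → Fin 4 → Fin 4 → ℝ) : Prop where
  antisymm : ∀ a b c d, R b a c d = - R a b c d
  pair : ∀ a b c d, R c d a b = R a b c d
  bianchi : ∀ a b c d, R a b c d + R a c d b + R a d b c = 0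

variable {g : C2 → Matrix (Fin 4) (Fin 4) ℝ} {z : C2}

theorem inv_symm (hs : (g z).transpose = g z) (a b : Fin 4) : (g z)⁻¹ a b = (g z)⁻¹ b a := by
  conv_lhs => rw [← hs, ← Matrix.transpose_nonsing_inv]
  rfl

theorem riemannUp_eq (hdet : (g z).det ≠ 0) (a c a' b : Fin 4) :
    riemannUp g z a c a' b = ∑ d, (g z)⁻¹ a d * riemann g z d c a' b := by
  have h2 : ((g z)⁻¹.mulVec ((g z).mulVec fun e => riemannUp g z e c a' b)) a =
      riemannUp g z a c a' b := by
    rw [Matrix.mulVec_mulVec, Matrix.nonsing_inv_mul _ (isUnit_iff_ne_zero.2 hdet),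
      Matrix.one_mulVec]
  rw [← h2]
  rfl

theorem ricci_eq (hdet : (g z).det ≠ 0) (c b : Fin 4) :
    ricci g z c b = ∑ a, ∑ d, (g z)⁻¹ a d * riemann g z d c a b := by
  simp only [ricci, riemannUp_eq hdet]

theorem ricci_symm (hdet : (g z).det ≠ 0) (hs : (g z).transpose = g z)
    (hR : IsCurvature (riemann g z)) (c b : Fin 4) : ricci g z c b = ricci g z b c := by
  rw [ricci_eq hdet, ricci_eq hdet, Finset.sum_comm]
  refine Finset.sum_congr rfl fun a _ => Finset.sum_congr rfl fun d _ => ?_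
  rw [inv_symm hs, hR.pair]

theorem weyl_isCurvature (hdet : (g z).det ≠ 0) (hs : (g z).transpose = g z)
    (hR : IsCurvature (riemann g z)) : IsCurvature (weyl g z) := by
  have hs' : ∀ a b, g z b a = g z a b := fun a b => congrFun (congrFun hs a) b
  have hr := ricci_symm hdet hs hR
  constructor
  · intro a b c d
    simp only [weyl]
    linear_combination hR.antisymm a b c d
  · intro a b c d
    simp only [weyl]
    rw [hR.pair, hs' a c, hs' b d, hs' a d, hs' b c, hr c a, hr d b, hr c b, hr d a]
    ring
  · intro a b c d
    simp only [weyl]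
    rw [hs' c b, hs' d b, hs' d c, hr c b, hr d b, hr d c]
    linear_combination hR.bianchi a b c d

/-- The coefficients 1/2 and 1/6 are those of dimension four: Ric − ½(4 − 1 − 1)Ric − ½sg + (s/6)(4
− 1)g = 0. -/
theorem weyl_trace (hdet : (g z).det ≠ 0) (hs : (g z).transpose = g z)
    (hR : IsCurvature (riemann g z)) (b d : Fin 4) :
    ∑ a, ∑ c, (g z)⁻¹ a c * weyl g z a b c d = 0 := by
  have hs' : ∀ a b, g z b a = g z a b := fun a b => congrFun (congrFun hs a) b
  have hr := ricci_symm hdet hs hR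
  have hi := inv_symm hs
  have hu : IsUnit (g z).det := isUnit_iff_ne_zero.2 hdet
  have h1 : ∀ c d, ∑ a, (g z)⁻¹ c a * g z a d = if c = d then 1 else 0 := fun c d => by
    have := congrFun (congrFun (Matrix.nonsing_inv_mul _ hu) c) d
    rwa [Matrix.mul_apply, Matrix.one_apply] at this
  have A1 : ∑ a, ∑ c, (g z)⁻¹ a c * riemann g z a b c d = ricci g z b d := by
    rw [ricci_eq hdet, Finset.sum_comm]
    exact Finset.sum_congr rfl fun a _ => Finset.sum_congr rfl fun c _ => by rw [hi]
  have A2 : ∑ a, ∑ c, (g z)⁻¹ a c * (g z a c * ricci g z b d) = 4 * ricci g z b d := by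
    have : ∀ a, ∑ c, (g z)⁻¹ a c * (g z a c * ricci g z b d) = ricci g z b d := fun a => by
      have h2 := h1 a a
      rw [if_pos rfl] at h2
      refine Eq.trans ?_ (one_mul (ricci g z b d))
      rw [← h2, Finset.sum_mul]
      exact Finset.sum_congr rfl fun c _ => by rw [hs' a c, mul_assoc]
    simp [this]
  have A3 : ∀ T : Fin 4 → Fin 4 → ℝ,
      ∑ a, ∑ c, (g z)⁻¹ a c * (g z a d * T b c) = T b d := fun T => by
    rw [Finset.sum_comm]
    have : ∀ c, ∑ a, (g z)⁻¹ a c * (g z a d * T b c) = (if c = d then 1 else 0) * T b c :=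
      fun c => by
        rw [← h1, Finset.sum_mul]
        exact Finset.sum_congr rfl fun a _ => by rw [hi]; ring
    simp [this]
  have A4 : ∀ T : Fin 4 → Fin 4 → ℝ,
      ∑ a, ∑ c, (g z)⁻¹ a c * (g z b c * T a d) = T b d := fun T => by
    have : ∀ a, ∑ c, (g z)⁻¹ a c * (g z b c * T a d) = (if a = b then 1 else 0) * T a d :=
      fun a => by
        rw [← h1, Finset.sum_mul]
        exact Finset.sum_congr rfl fun c _ => by rw [hs' b c]; ring
    simp [this]
  have A5 : ∑ a, ∑ c, (g z)⁻¹ a c * (g z b d * ricci g z a c) = g z b d * scalar g z := by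
    simp only [scalar, Finset.mul_sum]
    exact Finset.sum_congr rfl fun a _ => Finset.sum_congr rfl fun c _ => by ring
  have A6 : ∑ a, ∑ c, (g z)⁻¹ a c * (g z a c * g z b d) = 4 * g z b d := by
    have : ∀ a, ∑ c, (g z)⁻¹ a c * (g z a c * g z b d) = g z b d := fun a => by
      have h2 := h1 a a
      rw [if_pos rfl] at h2
      refine Eq.trans ?_ (one_mul (g z b d))
      rw [← h2, Finset.sum_mul]
      exact Finset.sum_congr rfl fun c _ => by rw [hs' a c, mul_assoc]
    simp [this]
  calc ∑ a, ∑ c, (g z)⁻¹ a c * weyl g z a b c d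
      = ∑ a, ∑ c, ((g z)⁻¹ a c * riemann g z a b c d
        - (1 / 2) * ((g z)⁻¹ a c * (g z a c * ricci g z b d)
          - (g z)⁻¹ a c * (g z a d * ricci g z b c)
          - (g z)⁻¹ a c * (g z b c * ricci g z a d) + (g z)⁻¹ a c * (g z b d * ricci g z a c))
        + (scalar g z / 6) * ((g z)⁻¹ a c * (g z a c * g z b d)
          - (g z)⁻¹ a c * (g z a d * g z b c))) :=
        Finset.sum_congr rfl fun a _ => Finset.sum_congr rfl fun c _ => by
          simp only [weyl]; ring
    _ = 0 := by
        simp only [Finset.sum_add_distrib, Finset.sum_sub_distrib, ← Finset.mul_sum]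
        rw [A1, A2, A3 (ricci g z), A4 (ricci g z), A5, A6, A3 (g z)]
        ring

/-- Kulkarni–Nomizu products with a metric vanish on its null bivectors. -/
theorem ev4_null (R : Fin 4 → Fin 4 → Fin 4 → Fin 4 → ℝ) (G T : Fin 4 → Fin 4 → ℝ) (r : ℝ)
    {u v : Fin 4 → ℂ} (huu : ev2 G u u = 0) (huv : ev2 G u v = 0)
    (hvu : ev2 G v u = 0) (hvv : ev2 G v v = 0) :
    ev4 (fun a b c d => R a b c d
      - (1 / 2) * (G a c * T b d - G a d * T b c - G b c * T a d + G b d * T a c)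
      + r * (G a c * G b d - G a d * G b c)) u v u v = ev4 R u v u v := by
  have e1 : ∀ P Q : Fin 4 → Fin 4 → ℝ, ev4 (fun a b c d => P a c * Q b d) u v u v =
      ev2 P u u * ev2 Q v v := fun P Q => by
    rw [ev4_swap₂₃ (fun a b c d => P a b * Q c d), ev4_prod]
  have e2 : ∀ P Q : Fin 4 → Fin 4 → ℝ, ev4 (fun a b c d => P a d * Q b c) u v u v =
      ev2 P u v * ev2 Q v u := fun P Q => by
    rw [ev4_swap₃₄ (fun a b c d => P a c * Q b d), ev4_swap₂₃ (fun a b c d => P a b * Q c d),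
      ev4_prod]
  have e3 : ∀ P Q : Fin 4 → Fin 4 → ℝ, ev4 (fun a b c d => P b c * Q a d) u v u v =
      ev2 P v u * ev2 Q u v := fun P Q => by
    have := e2 Q P
    simp only [mul_comm] at this ⊢
    exact this
  have e4 : ∀ P Q : Fin 4 → Fin 4 → ℝ, ev4 (fun a b c d => P b d * Q a c) u v u v =
      ev2 P v v * ev2 Q u u := fun P Q => by
    have := e1 Q P
    simp only [mul_comm] at this ⊢
    exact this
  simp only [ev4_add_tensor, ev4_sub_tensor, ev4_mul_tensor, e1, e2, e3, e4]
  rw [huu, huv, hvu, hvv]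
  ring

/-- On a null bivector the Weyl tensor coincides with the Riemann tensor. -/
theorem ev4_weyl {u v : Fin 4 → ℂ} (huu : bil (g z) u u = 0) (huv : bil (g z) u v = 0)
    (hvu : bil (g z) v u = 0) (hvv : bil (g z) v v = 0) :
    ev4 (weyl g z) u v u v = ev4 (riemann g z) u v u v :=
  ev4_null (riemann g z) (fun a b => g z a b) (ricci g z) (scalar g z / 6) huu huv hvu hvv

/-- The products `⟨f₀, f₂⟩ = ⟨f₁, f₃⟩ = 1` of a null frame. -/
def nullFrame : Matrix (Fin 4) (Fin 4) ℂ := !![0, 0, 1, 0; 0, 0, 0, 1; 1, 0, 0, 0; 0, 1, 0, 0]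

theorem nullFrame_mul_self : nullFrame * nullFrame = 1 := by
  ext i j
  fin_cases i <;> fin_cases j <;> simp [nullFrame, Matrix.mul_apply, Fin.sum_univ_four]

/-- The bivector in `hnull` is s² F₀∧F₃ − t² F₁∧F₂ − st(F₀∧F₂ − F₁∧F₃), a parametrization of the
null cone of Λ⁻. Its plane is isotropic, so the Weyl tensor vanishes there too. The result is a
quartic form in (s,t), and its five coefficients give the hypotheses `h4`, `h0`, `h3`, `h1`, `h2` of
`weyl_frame`. -/
theorem weyl_null_frame (hdet : (g z).det ≠ 0) (hs : (g z).transpose = g z)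
    (hR : IsCurvature (riemann g z)) {F : Fin 4 → Fin 4 → ℂ}
    (hF : ∀ A B, bil (g z) (F A) (F B) = nullFrame A B)
    (hnull : ∀ s t : ℂ, ev4 (riemann g z) (s • F 0 + t • F 1) ((-t) • F 2 + s • F 3)
      (s • F 0 + t • F 1) ((-t) • F 2 + s • F 3) = 0) (c d : Fin 4) :
    ev2 (fun a b => weyl g z a b c d) (F 0) (F 3) = 0 ∧
    ev2 (fun a b => weyl g z a b c d) (F 1) (F 2) = 0 ∧
    ev2 (fun a b => weyl g z a b c d) (F 0) (F 2) =
      ev2 (fun a b => weyl g z a b c d) (F 1) (F 3) := by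
  have hW := weyl_isCurvature hdet hs hR
  set w : Fin 4 → Fin 4 → Fin 4 → Fin 4 → ℂ :=
    fun A B C D => ev4 (weyl g z) (F A) (F B) (F C) (F D) with hw
  have hWn : ∀ s t : ℂ, ev4 (weyl g z) (s • F 0 + t • F 1) ((-t) • F 2 + s • F 3)
      (s • F 0 + t • F 1) ((-t) • F 2 + s • F 3) = 0 := fun s t => by
    rw [ev4_weyl, hnull]
    all_goals
      simp only [bil_add_left, bil_add_right, bil_smul_left, bil_smul_right, hF]
      simp [nullFrame]
      try ring
  simp only [ev4_add₁, ev4_add₂, ev4_add₃, ev4_add₄, ev4_smul₁, ev4_smul₂, ev4_smul₃,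
    ev4_smul₄] at hWn
  have h12 : ∀ A B C D, w B A C D = - w A B C D := fun A B C D => by
    calc w B A C D = ev4 (fun a b c d => weyl g z b a c d) (F A) (F B) (F C) (F D) :=
          (ev4_swap₁₂ _ _ _ _ _).symm
      _ = ev4 (fun a b c d => - weyl g z a b c d) (F A) (F B) (F C) (F D) := by
          congr 1; funext a b c d; exact hW.antisymm a b c d
      _ = _ := ev4_neg_tensor _ _ _ _ _
  have hp : ∀ A B C D, w C D A B = w A B C D := fun A B C D => by
    calc w C D A B = ev4 (fun a b c d => weyl g z c d a b) (F A) (F B) (F C) (F D) := by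
          rw [ev4_swap₂₃ (fun a b c d => weyl g z b d a c), ev4_swap₁₂ (fun a b c d =>
            weyl g z a d b c), ev4_swap₃₄ (fun a b c d => weyl g z a c b d), ev4_swap₂₃]
      _ = w A B C D := by
          congr 1; funext a b c d; exact hW.pair a b c d
  have hb : ∀ A B C D, w A B C D + w A C D B + w A D B C = 0 := fun A B C D => by
    have h1 : w A C D B = ev4 (fun a b c d => weyl g z a c d b) (F A) (F B) (F C) (F D) := by
      rw [ev4_swap₂₃ (fun a b c d => weyl g z a b d c), ev4_swap₃₄]
    have h2 : w A D B C = ev4 (fun a b c d => weyl g z a d b c) (F A) (F B) (F C) (F D) := by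
      rw [ev4_swap₃₄ (fun a b c d => weyl g z a c b d), ev4_swap₂₃]
    rw [h1, h2]
    simp only [hw]
    rw [← ev4_add_tensor, ← ev4_add_tensor]
    simp only [hW.bianchi]
    simp [ev4]
  have hexp : ∀ A B C D, w A B C D = ∑ c, ∑ d,
      ev2 (fun a b => weyl g z a b c d) (F A) (F B) * F C c * F D d := fun A B C D => by
    simp only [hw]
    calc _ = ev4 (fun a b c d => weyl g z c d a b) (F C) (F D) (F A) (F B) := by
          rw [ev4_swap₂₃ (fun a b c d => weyl g z b d a c), ev4_swap₁₂ (fun a b c d =>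
            weyl g z a d b c), ev4_swap₃₄ (fun a b c d => weyl g z a c b d), ev4_swap₂₃]
      _ = _ := by
          simp only [ev4, ev2, Finset.sum_mul]
          exact Finset.sum_congr rfl fun _ _ => Finset.sum_congr rfl fun _ _ =>
            Finset.sum_congr rfl fun _ _ => Finset.sum_congr rfl fun _ _ => by ring
  have ht : ∀ B D, w 0 B 2 D + w 2 B 0 D + (w 1 B 3 D + w 3 B 1 D) = 0 := fun B D => by
    have h1 : ∑ b, ∑ d, (∑ a, ∑ c, ((((g z)⁻¹ a c : ℝ) : ℂ)) * (weyl g z a b c d : ℂ))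
        * F B b * F D d = 0 := by
      refine Finset.sum_eq_zero fun b _ => Finset.sum_eq_zero fun d _ => ?_
      have := weyl_trace hdet hs hR b d
      have h2 : (∑ a, ∑ c, (((g z)⁻¹ a c : ℝ) : ℂ) * (weyl g z a b c d : ℂ)) = 0 := by
        exact_mod_cast this
      rw [h2]; ring
    rw [← h1]
    -- `nullFrame` is its own inverse, so the inverse metric is the symmetrized sum of F₀⊗F₂ and
    -- F₁⊗F₃.
    have h3 : ∀ a c, (((g z)⁻¹ a c : ℝ) : ℂ) =
        F 0 a * F 2 c + F 2 a * F 0 c + (F 1 a * F 3 c + F 3 a * F 1 c) := fun a c => by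
      rw [inv_eq_frame hF nullFrame_mul_self]
      simp [nullFrame, Fin.sum_univ_four]
      ring
    have h4 : ∀ x y : Fin 4 → ℂ, ev4 (weyl g z) x (F B) y (F D) =
        ∑ b, ∑ d, (∑ a, ∑ c, x a * y c * (weyl g z a b c d : ℂ)) * F B b * F D d := fun x y => by
      have : ev4 (weyl g z) x (F B) y (F D) =
          ev4 (fun a b c d => weyl g z c a d b) (F B) (F D) x y := by
        rw [ev4_swap₂₃ (fun a b c d => weyl g z b a d c), ev4_swap₁₂ (fun a b c d =>
          weyl g z a b d c), ev4_swap₃₄]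
      rw [this]
      simp only [ev4, Finset.sum_mul]
      exact Finset.sum_congr rfl fun _ _ => Finset.sum_congr rfl fun _ _ =>
            Finset.sum_congr rfl fun _ _ => Finset.sum_congr rfl fun _ _ => by ring
    simp only [hw, h4, ← Finset.sum_add_distrib, ← add_mul, h3]
  have hw' : ∀ A B C D, ev4 (weyl g z) (F A) (F B) (F C) (F D) = w A B C D :=
    fun _ _ _ _ => rfl
  have q : ∀ s t : ℂ, s ^ 4 * w 0 3 0 3 + t ^ 4 * w 1 2 1 2
      - 2 * s ^ 3 * t * (w 0 3 0 2 - w 0 3 1 3) + 2 * s * t ^ 3 * (w 1 2 0 2 - w 1 2 1 3)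
      + s ^ 2 * t ^ 2 * (w 0 2 0 2 + w 1 3 1 3 - 2 * w 0 2 1 3 - 2 * w 0 3 1 2) = 0 :=
    fun s t => by
      have := hWn s t
      simp only [hw'] at this
      linear_combination this + s * t ^ 3 * (hp 0 2 1 2 - hp 1 3 1 2)
        + s ^ 2 * t ^ 2 * (hp 0 2 1 3 + hp 0 3 1 2) + s ^ 3 * t * (hp 0 3 0 2 + hp 1 3 0 3)
  -- The coefficients of the quartic are recovered by interpolation: the odd ones from its odd part
  -- at t = 1 and t = 2, the middle one from its even part at t = 1.
  have key := weyl_frame h12 hp hb ht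
    (by linear_combination q 1 0)
    (by linear_combination q 0 1) 
    (by linear_combination (-1 / 3) * (q 1 1 - q 1 (-1)) + (1 / 24) * (q 1 2 - q 1 (-2)))
    (by linear_combination (-1 / 12) * (q 1 1 - q 1 (-1)) + (1 / 24) * (q 1 2 - q 1 (-2)))
    (by linear_combination (1 / 2) * (q 1 1 + q 1 (-1)) - q 1 0 - q 0 1)
  -- `weyl_frame` has frame vectors in all four slots; since the frame is a basis, the last two can
  -- be traded for coordinate indices.
  have hz : ∀ B : Matrix (Fin 4) (Fin 4) ℂ, (∀ C D, ∑ c, ∑ d, B c d * F C c * F D d = 0) → B = 0 :=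
    fun B => eq_zero_of_frame hF nullFrame_mul_self
  refine ⟨?_, ?_, ?_⟩
  · exact congrFun (congrFun (hz (Matrix.of fun c d =>
      ev2 (fun a b => weyl g z a b c d) (F 0) (F 3)) fun C D => by
      rw [← (key C D).1, hexp]; rfl) c) d
  · exact congrFun (congrFun (hz (Matrix.of fun c d =>
      ev2 (fun a b => weyl g z a b c d) (F 1) (F 2)) fun C D => by
      rw [← (key C D).2.1, hexp]; rfl) c) d
  · rw [← sub_eq_zero]
    exact congrFun (congrFun (hz (Matrix.of fun c d =>
      ev2 (fun a b => weyl g z a b c d) (F 0) (F 2) -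
      ev2 (fun a b => weyl g z a b c d) (F 1) (F 3)) fun C D => by
      simp only [Matrix.of_apply, sub_mul, Finset.sum_sub_distrib]
      rw [← hexp, ← hexp, (key C D).2.2, sub_self]) c) d

end Weyl

/-! ### The underlying Riemannian metric and its Hodge star -/

section Hermitian

variable {G : C2 → Matrix (Fin 2) (Fin 2) ℂ} {z : C2}

/-- The determinant of a Hermitian `2 × 2` matrix. -/
def hermDet (H : Matrix (Fin 2) (Fin 2) ℂ) : ℝ :=
  (H 0 0).re * (H 1 1).re - (H 0 1).re ^ 2 - (H 0 1).im ^ 2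

theorem realMetric_eq (hH : ∀ i j, G z j i = conj (G z i j)) :
    realMetric G z =
      !![2 * (G z 0 0).re, 0, 2 * (G z 0 1).re, 2 * (G z 0 1).im;
         0, 2 * (G z 0 0).re, -2 * (G z 0 1).im, 2 * (G z 0 1).re;
         2 * (G z 0 1).re, -2 * (G z 0 1).im, 2 * (G z 1 1).re, 0;
         2 * (G z 0 1).im, 2 * (G z 0 1).re, 0, 2 * (G z 1 1).re] := by
  have h0 : (G z 0 0).im = 0 := Complex.conj_eq_iff_im.1 (hH 0 0).symm
  have h1 : (G z 1 1).im = 0 := Complex.conj_eq_iff_im.1 (hH 1 1).symm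
  ext a b
  fin_cases a <;> fin_cases b <;>
    simp [realMetric, realBasis, Fin.sum_univ_two, h0, h1, hH 0 1]

theorem realMetric_symm (hH : ∀ i j, G z j i = conj (G z i j)) :
    (realMetric G z).transpose = realMetric G z := by
  rw [realMetric_eq hH]
  ext a b
  fin_cases a <;> fin_cases b <;> rfl

/-- A perfect square, so the root in `hodgeStar` becomes the polynomial 4 `hermDet` when `hermDet`
is positive. -/
theorem realMetric_det (hH : ∀ i j, G z j i = conj (G z i j)) :
    (realMetric G z).det = (4 * hermDet (G z)) ^ 2 := by
  rw [realMetric_eq hH, Matrix.det_succ_row_zero]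
  simp [Fin.sum_univ_succ, Matrix.det_fin_three, Fin.succAbove, hermDet]
  ring

theorem realMetric_inv (hH : ∀ i j, G z j i = conj (G z i j)) (hD : hermDet (G z) ≠ 0) :
    (realMetric G z)⁻¹ = (1 / (2 * hermDet (G z))) •
      !![(G z 1 1).re, 0, -(G z 0 1).re, -(G z 0 1).im;
         0, (G z 1 1).re, (G z 0 1).im, -(G z 0 1).re;
         -(G z 0 1).re, (G z 0 1).im, (G z 0 0).re, 0;
         -(G z 0 1).im, -(G z 0 1).re, 0, (G z 0 0).re] := by
  apply Matrix.inv_eq_right_inv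
  rw [realMetric_eq hH, Matrix.mul_smul]
  have : ∀ x : ℝ, 1 / (2 * hermDet (G z)) * x = 1 ↔ x = 2 * hermDet (G z) := fun x => by
    field_simp
  ext a b
  fin_cases a <;> fin_cases b <;>
    simp <;>
    first
    | (right; ring)
    | (field_simp; simp only [hermDet]; ring)

/-- The 0–1 matrix times the Vandermonde matrix of 0, 1, 2, 3 is the Vandermonde matrix of a, b, c,
d; take determinants. The constant 12 is the Vandermonde determinant of 0, 1, 2, 3. A polynomial
formula lets the Hodge star be evaluated by algebra. -/
theorem levi_eq (a b c d : Fin 4) : levi a b c d =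
    ((b : ℝ) - a) * ((c : ℝ) - a) * ((d : ℝ) - a) * ((c : ℝ) - b) * ((d : ℝ) - b)
      * ((d : ℝ) - c) / 12 := by
  have h : (Matrix.of fun i j : Fin 4 => if ![a, b, c, d] i = j then (1 : ℝ) else 0) *
      Matrix.vandermonde (fun i : Fin 4 => (i : ℝ)) =
      Matrix.vandermonde (fun i => ((![a, b, c, d] i : Fin 4) : ℝ)) := by
    ext i j
    simp [Matrix.mul_apply, Matrix.vandermonde_apply]
  have h2 := congrArg Matrix.det h
  rw [Matrix.det_mul, Matrix.det_vandermonde, Matrix.det_vandermonde] at h2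
  simp [Fin.prod_univ_succ] at h2
  rw [levi]
  linear_combination (1 / 12) * h2

/-- The hypotheses say that the (1,1)-part of `η` is r/2 times the fundamental form i g_{ij̄}
dzⁱ∧dz̄ʲ, with the (2,0)+(0,2)-part left free. These are exactly the self-dual forms of a Hermitian
surface. -/
theorem hodgeStar_eq (hH : ∀ i j, G z j i = conj (G z i j)) (hD : 0 < hermDet (G z))
    {η : Fin 4 → Fin 4 → ℝ} (ha : ∀ a b, η b a = - η a b) {r : ℝ}
    (h01 : η 0 1 = r * (G z 0 0).re) (h23 : η 2 3 = r * (G z 1 1).re)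
    (h02 : η 0 2 = - η 1 3 - 2 * r * (G z 0 1).im)
    (h03 : η 0 3 = η 1 2 + 2 * r * (G z 0 1).re) (a b : Fin 4) :
    hodgeStar (realMetric G) z η a b = η a b := by
  have h0 : ∀ a, η a a = 0 := fun a => by linarith [ha a a]
  have h10 := ha 0 1
  have h20 := ha 0 2
  have h30 := ha 0 3
  have h21 := ha 1 2
  have h31 := ha 1 3
  have h32 := ha 2 3
  rw [hodgeStar, realMetric_det hH, Real.sqrt_sq (by positivity), realMetric_inv hH hD.ne']
  have hD' := hD.ne'
  fin_cases a <;> fin_cases b <;>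
    simp [Fin.sum_univ_four, levi_eq, h0, h10, h20, h30, h21, h31, h32, h01, h02, h03, h23] <;>
    field_simp <;> simp only [hermDet] <;> ring

end Hermitian

/-! ### Vectors of type `(1,0)` and `(0,1)` -/

/-- The `(1,0)`-vector `Xⁱ ∂/∂zⁱ` in real coordinates. -/
def hol (X : C2) : Fin 4 → ℂ :=
  ![X 0 / 2, -Complex.I * X 0 / 2, X 1 / 2, -Complex.I * X 1 / 2]

/-- The `(0,1)`-vector `Yʲ ∂/∂z̄ʲ` in real coordinates. -/
def anti (Y : C2) : Fin 4 → ℂ :=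
  ![Y 0 / 2, Complex.I * Y 0 / 2, Y 1 / 2, Complex.I * Y 1 / 2]

theorem hol_add (X Y : C2) : hol (X + Y) = hol X + hol Y := by
  ext a; fin_cases a <;> simp [hol] <;> ring

theorem anti_add (X Y : C2) : anti (X + Y) = anti X + anti Y := by
  ext a; fin_cases a <;> simp [anti] <;> ring

theorem hol_smul (t : ℂ) (X : C2) : hol (t • X) = t • hol X := by
  ext a; fin_cases a <;> simp [hol] <;> ring

theorem anti_smul (t : ℂ) (X : C2) : anti (t • X) = t • anti X := by
  ext a; fin_cases a <;> simp [anti] <;> ring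

/-! ### Null frames adapted to a Hermitian metric -/

section Hermitian

variable {G : C2 → Matrix (Fin 2) (Fin 2) ℂ} {z : C2}

/-- The complex bilinear pairing `g_{i j̄} Xⁱ Yʲ`. -/
def pairing (H : Matrix (Fin 2) (Fin 2) ℂ) (X Y : C2) : ℂ := ∑ i, ∑ j, H i j * X i * Y j

theorem hermitian_components (hH : ∀ i j, G z j i = conj (G z i j)) :
    G z 0 0 = (G z 0 0).re ∧ G z 1 1 = (G z 1 1).re ∧
    G z 0 1 = (G z 0 1).re + (G z 0 1).im * Complex.I ∧
    G z 1 0 = (G z 0 1).re - (G z 0 1).im * Complex.I := by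
  refine ⟨(Complex.conj_eq_iff_re.1 (hH 0 0).symm).symm,
    (Complex.conj_eq_iff_re.1 (hH 1 1).symm).symm, (Complex.re_add_im _).symm, ?_⟩
  rw [hH 0 1]
  apply Complex.ext <;> simp

theorem bil_hol_anti (hH : ∀ i j, G z j i = conj (G z i j)) (X Y : C2) :
    bil (realMetric G z) (hol X) (anti Y) = pairing (G z) X Y := by
  obtain ⟨h0, h1, h2, h3⟩ := hermitian_components hH
  simp only [pairing, Fin.sum_univ_two]
  rw [h0, h1, h2, h3, realMetric_eq hH]
  simp [bil, hol, anti, Fin.sum_univ_four, -Complex.re_add_im]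
  ring_nf
  simp only [Complex.I_sq]
  ring

theorem bil_anti_hol (hH : ∀ i j, G z j i = conj (G z i j)) (X Y : C2) :
    bil (realMetric G z) (anti Y) (hol X) = pairing (G z) X Y := by
  obtain ⟨h0, h1, h2, h3⟩ := hermitian_components hH
  simp only [pairing, Fin.sum_univ_two]
  rw [h0, h1, h2, h3, realMetric_eq hH]
  simp [bil, hol, anti, Fin.sum_univ_four, -Complex.re_add_im]
  ring_nf
  simp only [Complex.I_sq]
  ring

theorem bil_hol_hol (hH : ∀ i j, G z j i = conj (G z i j)) (X Y : C2) :
    bil (realMetric G z) (hol X) (hol Y) = 0 := by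
  rw [realMetric_eq hH]
  simp [bil, hol, Fin.sum_univ_four]
  ring_nf
  simp only [Complex.I_sq]
  ring

theorem bil_anti_anti (hH : ∀ i j, G z j i = conj (G z i j)) (X Y : C2) :
    bil (realMetric G z) (anti X) (anti Y) = 0 := by
  rw [realMetric_eq hH]
  simp [bil, anti, Fin.sum_univ_four]
  ring_nf
  simp only [Complex.I_sq]
  ring

theorem hermDet_eq (hH : ∀ i j, G z j i = conj (G z i j)) :
    ((hermDet (G z) : ℝ) : ℂ) = G z 0 0 * G z 1 1 - G z 0 1 * G z 1 0 := by
  obtain ⟨h0, h1, h2, h3⟩ := hermitian_components hH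
  rw [h0, h1, h2, h3]
  simp [hermDet, -Complex.re_add_im]
  ring_nf
  simp only [Complex.I_sq]
  ring

/-- The anti-self-dual Weyl tensor of a Hermitian metric vanishes at a point as soon as the
curvature tensor vanishes on the null bivectors `X ∧ Ȳ` with `⟨X, Ȳ⟩ = 0`. -/
theorem weylMinusCoord_eq_zero (hH : ∀ i j, G z j i = conj (G z i j))
    (hp : 0 < (G z 0 0).re) (hD : 0 < hermDet (G z))
    (hR : IsCurvature (riemann (realMetric G) z))
    (hnull : ∀ X Y : C2, pairing (G z) X Y = 0 →
      ev4 (riemann (realMetric G) z) (hol X) (anti Y) (hol X) (anti Y) = 0) (a b c d : Fin 4) :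
    weylMinusCoord (realMetric G) z a b c d = 0 := by
  have hdet0 : (realMetric G z).det ≠ 0 := by rw [realMetric_det hH]; positivity
  obtain ⟨k0, k1, k2, k3⟩ := hermitian_components hH
  have hp' : G z 0 0 ≠ 0 := by
    rw [k0]; exact_mod_cast hp.ne'
  have hD' : ((hermDet (G z) : ℝ) : ℂ) ≠ 0 := by exact_mod_cast hD.ne'
  have hDe := hermDet_eq hH
  set D : ℂ := ((hermDet (G z) : ℝ) : ℂ) with hDdef
  -- `e0`, `e1` come from Gram–Schmidt without square roots, and `e2`, `e3` form the basis dual to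
  -- them under `pairing`, so the resulting frame has products `nullFrame`.
  set e0 : C2 := ![1, 0] with he0
  set e1 : C2 := ![-G z 1 0, G z 0 0] with he1
  set e2 : C2 := ![1 / G z 0 0, 0] with he2
  set e3 : C2 := ![-G z 0 1 / (G z 0 0 * D), 1 / D] with he3
  set F : Fin 4 → Fin 4 → ℂ := ![hol e0, hol e1, anti e2, anti e3] with hF
  have p02 : pairing (G z) e0 e2 = 1 := by
    simp [pairing, e0, e2, Fin.sum_univ_two]; field_simp
  have p03 : pairing (G z) e0 e3 = 0 := by
    simp [pairing, e0, e3, Fin.sum_univ_two]; field_simp; ring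
  have p12 : pairing (G z) e1 e2 = 0 := by
    simp [pairing, e1, e2, Fin.sum_univ_two]; field_simp; ring
  have p13 : pairing (G z) e1 e3 = 1 := by
    simp [pairing, e1, e3, Fin.sum_univ_two]; field_simp; rw [hDe]; ring
  have hFF : ∀ A B, bil (realMetric G z) (F A) (F B) = nullFrame A B := by
    intro A B
    fin_cases A <;> fin_cases B <;>
      simp [F, nullFrame, bil_hol_hol hH, bil_anti_anti hH, bil_hol_anti hH, bil_anti_hol hH,
        p02, p03, p12, p13]
  have hW := weyl_isCurvature hdet0 (realMetric_symm hH) hR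
  have key := weyl_null_frame hdet0 (realMetric_symm hH) hR hFF (fun s t => by
    have h1 : s • F 0 + t • F 1 = hol (s • e0 + t • e1) := by
      rw [hol_add, hol_smul, hol_smul]; rfl
    have h2 : (-t) • F 2 + s • F 3 = anti ((-t) • e2 + s • e3) := by
      rw [anti_add, anti_smul, anti_smul]; rfl
    rw [h1, h2]
    apply hnull
    have : pairing (G z) (s • e0 + t • e1) ((-t) • e2 + s • e3) =
        -(s * t) * pairing (G z) e0 e2 + s * s * pairing (G z) e0 e3
        - t * t * pairing (G z) e1 e2 + s * t * pairing (G z) e1 e3 := by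
      simp [pairing, Fin.sum_univ_two]; ring
    rw [this, p02, p03, p12, p13]; ring) c d
  set η : Fin 4 → Fin 4 → ℝ := fun a b => weyl (realMetric G) z a b c d with hη
  have ha : ∀ a b, η b a = - η a b := fun a b => hW.antisymm a b c d
  have h0 : ∀ a, η a a = 0 := fun a => by linarith [ha a a]
  obtain ⟨q1, q2, q3⟩ := key
  -- Only the (1,1)-part of `η` is seen here: η₀₁, η₂₃, η₀₂ + η₁₃ and η₀₃ − η₁₂.
  have hN : ∀ X Y : C2, ev2 η (hol X) (anti Y) =
      (1 / 4) * (X 0 * Y 0 * (2 * Complex.I * η 0 1) + X 1 * Y 1 * (2 * Complex.I * η 2 3)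
        + X 0 * Y 1 * ((η 0 2 + η 1 3) + Complex.I * (η 0 3 - η 1 2))
        + X 1 * Y 0 * (-(η 0 2 + η 1 3) + Complex.I * (η 0 3 - η 1 2))) := fun X Y => by
    simp [ev2, hol, anti, Fin.sum_univ_four, h0, ha 0 1, ha 0 2, ha 0 3, ha 1 2, ha 1 3, ha 2 3]
    ring_nf
    simp only [Complex.I_sq]
    ring
  have hI : Complex.I ≠ 0 := Complex.I_ne_zero
  have r1 : ev2 η (hol e0) (anti e3) = 0 := q1
  have r2 : ev2 η (hol e1) (anti e2) = 0 := q2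
  have r3 : ev2 η (hol e0) (anti e2) = ev2 η (hol e1) (anti e3) := q3
  rw [hN] at r1 r2
  rw [hN, hN] at r3
  simp [e0, e1, e2, e3] at r1 r2 r3
  field_simp at r1 r2 r3
  -- `s1` and `s2` express that this (1,1)-part is proportional to the fundamental form; the real
  -- and imaginary parts of `s1` become the conditions `h03` and `h02` of `hodgeStar_eq`, with r =
  -- η₀₁ / g₀₀.
  have s1 : G z 0 0 * ((η 0 2 + η 1 3) + Complex.I * (η 0 3 - η 1 2))
      = 2 * Complex.I * G z 0 1 * η 0 1 := by
    linear_combination r1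
  have s2 : G z 0 0 * (η 2 3 : ℂ) = G z 1 1 * η 0 1 := by
    refine mul_left_cancel₀ (mul_ne_zero (mul_ne_zero two_ne_zero hI) hp') ?_
    linear_combination -(r3 - G z 1 0 * r1 - G z 0 1 * r2) + 2 * Complex.I * η 0 1 * hDe
  rw [k0, k2] at s1
  rw [k0, k1] at s2
  have s1re := congrArg Complex.re s1
  have s1im := congrArg Complex.im s1
  simp at s1re s1im
  have s2' : (G z 0 0).re * η 2 3 = (G z 1 1).re * η 0 1 := by exact_mod_cast s2
  have hs := hodgeStar_eq hH hD ha (r := η 0 1 / (G z 0 0).re) (by field_simp)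
    (by field_simp; linarith) (by field_simp; linarith) (by field_simp; linarith) a b
  rw [weylMinusCoord, hs]
  ring

end Hermitian

/-! ### Curvature symmetries of the Riemann tensor -/

section Symmetries

variable {g : C2 → Matrix (Fin 4) (Fin 4) ℝ} {z : C2}

/-- The second derivatives `∂_a ∂_b g_{cd}`. -/
def jet2 (g : C2 → Matrix (Fin 4) (Fin 4) ℝ) (z : C2) (a b c d : Fin 4) : ℝ :=
  dR a (dR b (fun w => g w c d)) z

/-- The pairing `g^{ef} Γ_{e,ab} Γ_{f,cd}`. -/
def chrPair (g : C2 → Matrix (Fin 4) (Fin 4) ℝ) (z : C2) (a b c d : Fin 4) : ℝ :=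
  ∑ e, ∑ f, (g z)⁻¹ e f * (chrLow g e a b z * chrLow g f c d z)

theorem jet2_comm (hg : ∀ a b, ContDiffAt ℝ 2 (fun w => g w a b) z) (a b c d : Fin 4) :
    jet2 g z a b c d = jet2 g z b a c d := dR_dR_comm (hg c d) a b

theorem jet2_symm (hs : ∀ᶠ w in 𝓝 z, ∀ a b, g w a b = g w b a) (a b c d : Fin 4) :
    jet2 g z a b c d = jet2 g z a b d c := by
  have h : (fun w => g w c d) =ᶠ[𝓝 z] fun w => g w d c := by
    filter_upwards [hs] with w hw using hw c d
  have h2 : dR b (fun w => g w c d) =ᶠ[𝓝 z] dR b (fun w => g w d c) := by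
    filter_upwards [h.fderiv (𝕜 := ℝ)] with w hw
    simp only [dR, hw]
  exact congrArg (fun L : C2 →L[ℝ] ℝ => L (realBasis a)) h2.fderiv_eq

/-- The term ∂_a∂_b g_{dc} occurs in both derivatives of Christoffel symbols and cancels. In the
form that is left, the algebraic symmetries of the curvature follow from those of `jet2` and
`chrPair`. -/
theorem riemann_eq_jet (hg : ∀ a b, ContDiffAt ℝ 2 (fun w => g w a b) z)
    (hs : ∀ᶠ w in 𝓝 z, ∀ a b, g w a b = g w b a)
    (hdet : (g z).det ≠ 0) (d c a b : Fin 4) :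
    riemann g z d c a b = (1 / 2) * (jet2 g z a c d b - jet2 g z a d b c - jet2 g z b c d a
      + jet2 g z b d a c) - chrPair g z a d b c + chrPair g z b d a c := by
  rw [riemann_eq hg hs hdet, dR_chrLow hg, dR_chrLow hg]
  have := jet2_comm hg a b d c
  simp only [jet2, chrPair] at this ⊢
  linear_combination (1 / 2) * this

theorem isCurvature_riemann (hg : ∀ a b, ContDiffAt ℝ 2 (fun w => g w a b) z)
    (hs : ∀ᶠ w in 𝓝 z, ∀ a b, g w a b = g w b a)
    (hdet : (g z).det ≠ 0) : IsCurvature (riemann g z) := by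
  have hJ := jet2_comm hg
  have hJ' := jet2_symm hs
  have hz : (g z).transpose = g z := by
    ext a b
    exact hs.self_of_nhds b a
  have hP1 : ∀ a b c d, chrPair g z a b c d = chrPair g z b a c d := fun a b c d =>
    Finset.sum_congr rfl fun e _ => Finset.sum_congr rfl fun f _ => by rw [chrLow_comm hs e a b]
  have hP2 : ∀ a b c d, chrPair g z a b c d = chrPair g z c d a b := fun a b c d => by
    simp only [chrPair]
    rw [Finset.sum_comm]
    exact Finset.sum_congr rfl fun e _ => Finset.sum_congr rfl fun f _ => by
      rw [inv_symm hz]; ring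
  constructor
  · intro d c a b
    rw [riemann_eq_jet hg hs hdet, riemann_eq_jet hg hs hdet]
    grind
  · intro d c a b
    rw [riemann_eq_jet hg hs hdet, riemann_eq_jet hg hs hdet]
    grind
  · intro d c a b
    rw [riemann_eq_jet hg hs hdet, riemann_eq_jet hg hs hdet, riemann_eq_jet hg hs hdet]
    grind

end Symmetries

/-! ### Complex directional derivatives -/

section Derivatives

/-- The complex linear extension of the directional derivative. -/
def dC (x : Fin 4 → ℂ) (F : C2 → ℂ) (z : C2) : ℂ := ∑ a, x a * fderiv ℝ F z (realBasis a)

/-- The complex multilinear extension of a 3-tensor. -/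
def ev3 (T : Fin 4 → Fin 4 → Fin 4 → ℝ) (x u v : Fin 4 → ℂ) : ℂ :=
  ∑ a, ∑ b, ∑ c, (T a b c : ℂ) * x a * u b * v c

variable {g : C2 → Matrix (Fin 4) (Fin 4) ℝ} {z : C2}

theorem realBasis_eq : realBasis = ![Pi.single 0 1, Pi.single 0 Complex.I, Pi.single 1 1,
    Pi.single 1 Complex.I] := by
  ext a i
  fin_cases a <;> fin_cases i <;> simp [realBasis]

theorem dz_eq (i : Fin 2) (F : C2 → ℂ) : dz i F z = dC (hol (Pi.single i 1)) F z := by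
  fin_cases i <;> simp [dz, dC, hol, Fin.sum_univ_four, realBasis_eq] <;> ring

theorem dzbar_eq (i : Fin 2) (F : C2 → ℂ) : dzbar i F z = dC (anti (Pi.single i 1)) F z := by
  fin_cases i <;> simp [dzbar, dC, anti, Fin.sum_univ_four, realBasis_eq] <;> ring

theorem fderiv_sum_mul {f : Fin 4 → Fin 4 → C2 → ℝ} (hf : ∀ a b, DifferentiableAt ℝ (f a b) z)
    (u v : Fin 4 → ℂ) (y : C2) :
    fderiv ℝ (fun w => ∑ a, ∑ b, (f a b w : ℂ) * u a * v b) z y =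
      ∑ a, ∑ b, ((fderiv ℝ (f a b) z y : ℝ) : ℂ) * u a * v b := by
  have h : HasFDerivAt (fun w => ∑ a, ∑ b, (f a b w : ℂ) * u a * v b)
      (∑ a, ∑ b, (((Complex.ofRealCLM.comp (fderiv ℝ (f a b) z)).smulRight (u a)).smulRight (v b)
        : C2 →L[ℝ] ℂ)) z := by
    refine HasFDerivAt.fun_sum fun a _ => HasFDerivAt.fun_sum fun b _ => ?_
    have h1 : HasFDerivAt (fun w => (f a b w : ℂ)) (Complex.ofRealCLM.comp (fderiv ℝ (f a b) z)) z :=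
      Complex.ofRealCLM.hasFDerivAt.comp z (hf a b).hasFDerivAt
    have := (h1.mul_const (u a)).mul_const (v b)
    refine this.congr_fderiv ?_
    ext y
    simp
    ring
  rw [h.fderiv]
  simp

/-- The vectors `u`, `v` are constant in the coordinates, so only the metric is differentiated. -/
theorem dC_bil (hg : ∀ a b, DifferentiableAt ℝ (fun w => g w a b) z) (x u v : Fin 4 → ℂ) :
    dC x (fun w => bil (g w) u v) z = ev3 (fun a b c => dR a (fun w => g w b c) z) x u v := by
  simp only [dC, bil, fderiv_sum_mul hg, ev3, dR, Finset.mul_sum]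
  exact Finset.sum_congr rfl fun _ _ => Finset.sum_congr rfl fun _ _ =>
    Finset.sum_congr rfl fun _ _ => by ring

theorem dC_dC_bil (hg : ∀ a b, ContDiffAt ℝ 2 (fun w => g w a b) z) (x y u v : Fin 4 → ℂ) :
    dC x (dC y (fun w => bil (g w) u v)) z = ev4 (jet2 g z) x y u v := by
  have hev : ∀ᶠ w in 𝓝 z, ∀ a b, DifferentiableAt ℝ (fun w => g w a b) w := by
    have : ∀ a b, ∀ᶠ w in 𝓝 z, DifferentiableAt ℝ (fun w => g w a b) w := fun a b => by
      filter_upwards [(hg a b).eventually (by simp)] with w hw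
      exact hw.differentiableAt (by norm_num)
    exact Filter.eventually_all.2 fun a => Filter.eventually_all.2 fun b => this a b
  have h1 : dC y (fun w => bil (g w) u v) =ᶠ[𝓝 z]
      fun w => ∑ b, y b * ∑ c, ∑ d, ((dR b (fun w => g w c d) w : ℝ) : ℂ) * u c * v d := by
    filter_upwards [hev] with w hw
    rw [dC_bil hw]
    simp only [ev3, Finset.mul_sum]
    exact Finset.sum_congr rfl fun _ _ => Finset.sum_congr rfl fun _ _ =>
      Finset.sum_congr rfl fun _ _ => by ring
  have h2 : ∀ b, DifferentiableAt ℝ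
      (fun w => ∑ c, ∑ d, ((dR b (fun w => g w c d) w : ℝ) : ℂ) * u c * v d) z := fun b => by
    refine DifferentiableAt.fun_sum fun c _ => DifferentiableAt.fun_sum fun d _ => ?_
    exact ((Complex.ofRealCLM.differentiableAt.comp z
      (differentiableAt_dR (hg c d) b)).mul_const _).mul_const _
  have h3 : ∀ t : C2, fderiv ℝ (dC y (fun w => bil (g w) u v)) z t =
      ∑ b, y b * ∑ c, ∑ d, ((fderiv ℝ (dR b (fun w => g w c d)) z t : ℝ) : ℂ) * u c * v d :=
    fun t => by
      rw [h1.fderiv_eq, (HasFDerivAt.fun_sum (u := Finset.univ) fun b _ =>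
        ((h2 b).hasFDerivAt.const_mul (y b))).fderiv]
      simp only [sum_apply, smul_apply, smul_eq_mul]
      exact Finset.sum_congr rfl fun b _ => by
        rw [fderiv_sum_mul fun c d => differentiableAt_dR (hg c d) b]
  rw [dC]
  simp only [h3, ev4, jet2, Finset.mul_sum]
  exact Finset.sum_congr rfl fun _ _ => Finset.sum_congr rfl fun _ _ =>
    Finset.sum_congr rfl fun _ _ => Finset.sum_congr rfl fun _ _ => by
      rw [dR]; ring

end Derivatives

/-! ### Comparison with the Chern curvature -/

section Ev3

variable (T S : Fin 4 → Fin 4 → Fin 4 → ℝ) (x x' u u' v v' : Fin 4 → ℂ) (t : ℂ)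

theorem ev3_add₁ : ev3 T (x + x') u v = ev3 T x u v + ev3 T x' u v := by
  simp only [ev3, Pi.add_apply, mul_add, add_mul, Finset.sum_add_distrib]

theorem ev3_add₂ : ev3 T x (u + u') v = ev3 T x u v + ev3 T x u' v := by
  simp only [ev3, Pi.add_apply, mul_add, add_mul, Finset.sum_add_distrib]

theorem ev3_add₃ : ev3 T x u (v + v') = ev3 T x u v + ev3 T x u v' := by
  simp only [ev3, Pi.add_apply, mul_add, Finset.sum_add_distrib]

theorem ev3_smul₁ : ev3 T (t • x) u v = t * ev3 T x u v := by
  simp only [ev3, Pi.smul_apply, smul_eq_mul, Finset.mul_sum]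
  exact Finset.sum_congr rfl fun _ _ => Finset.sum_congr rfl fun _ _ =>
    Finset.sum_congr rfl fun _ _ => by ring

theorem ev3_smul₂ : ev3 T x (t • u) v = t * ev3 T x u v := by
  simp only [ev3, Pi.smul_apply, smul_eq_mul, Finset.mul_sum]
  exact Finset.sum_congr rfl fun _ _ => Finset.sum_congr rfl fun _ _ =>
    Finset.sum_congr rfl fun _ _ => by ring

theorem ev3_smul₃ : ev3 T x u (t • v) = t * ev3 T x u v := by
  simp only [ev3, Pi.smul_apply, smul_eq_mul, Finset.mul_sum]
  exact Finset.sum_congr rfl fun _ _ => Finset.sum_congr rfl fun _ _ =>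
    Finset.sum_congr rfl fun _ _ => by ring

theorem ev3_add_tensor :
    ev3 (fun a b c => T a b c + S a b c) x u v = ev3 T x u v + ev3 S x u v := by
  simp only [ev3, Complex.ofReal_add, add_mul, Finset.sum_add_distrib]

theorem ev3_sub_tensor :
    ev3 (fun a b c => T a b c - S a b c) x u v = ev3 T x u v - ev3 S x u v := by
  simp only [ev3, Complex.ofReal_sub, sub_mul, Finset.sum_sub_distrib]

theorem ev3_mul_tensor (r : ℝ) : ev3 (fun a b c => r * T a b c) x u v = r * ev3 T x u v := by
  simp only [ev3, Complex.ofReal_mul, mul_assoc, Finset.mul_sum]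

theorem ev3_swap₁₂ : ev3 (fun a b c => T b a c) x u v = ev3 T u x v := by
  rw [ev3, Finset.sum_comm]
  exact Finset.sum_congr rfl fun _ _ => Finset.sum_congr rfl fun _ _ =>
    Finset.sum_congr rfl fun _ _ => by ring

theorem ev3_swap₂₃ : ev3 (fun a b c => T a c b) x u v = ev3 T x v u := by
  refine Finset.sum_congr rfl fun _ _ => ?_
  rw [Finset.sum_comm]
  exact Finset.sum_congr rfl fun _ _ => Finset.sum_congr rfl fun _ _ => by ring

end Ev3

/-! ### Christoffel symbols and curvature in complex frames -/

section Real

variable {g : C2 → Matrix (Fin 4) (Fin 4) ℝ} {z : C2}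

/-- The complex trilinear extension of `∂_a g_{bc}`. -/
def jet1 (g : C2 → Matrix (Fin 4) (Fin 4) ℝ) (z : C2) (x u v : Fin 4 → ℂ) : ℂ :=
  ev3 (fun a b c => dR a (fun w => g w b c) z) x u v

/-- The complex trilinear extension of the Christoffel symbols of the first kind. -/
def chrExt (g : C2 → Matrix (Fin 4) (Fin 4) ℝ) (z : C2) (x u v : Fin 4 → ℂ) : ℂ :=
  ev3 (fun a b c => chrLow g a b c z) x u v

theorem chrExt_eq (x u v : Fin 4 → ℂ) :
    chrExt g z x u v = (1 / 2) * (jet1 g z u x v + jet1 g z v x u - jet1 g z x u v) := by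
  have h : (fun a b c => chrLow g a b c z) = fun a b c => (1 / 2) *
    (dR b (fun w => g w a c) z + dR c (fun w => g w a b) z - dR a (fun w => g w b c) z) := rfl
  rw [chrExt, h, ev3_mul_tensor, ev3_sub_tensor, ev3_add_tensor]
  rw [ev3_swap₁₂ (fun a b c => dR a (fun w => g w b c) z),
    ev3_swap₂₃ (fun a b c => dR b (fun w => g w a c) z),
    ev3_swap₁₂ (fun a b c => dR a (fun w => g w b c) z)]
  simp [jet1]

/-- The pairing of Christoffel symbols in a complex frame. -/
theorem ev4_chrPair {F : Fin 4 → Fin 4 → ℂ} {N K : Matrix (Fin 4) (Fin 4) ℂ}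
    (hF : ∀ A B, bil (g z) (F A) (F B) = N A B) (hK : N * K = 1) (x y u v : Fin 4 → ℂ) :
    ev4 (chrPair g z) x y u v =
      ∑ A, ∑ B, K A B * (chrExt g z (F A) x y * chrExt g z (F B) u v) := by
  have e : ∀ (w x y : Fin 4 → ℂ), chrExt g z w x y =
      ∑ e, w e * ev2 (fun a b => chrLow g e a b z) x y := fun w x y => by
    simp only [chrExt, ev3, ev2, Finset.mul_sum]
    exact Finset.sum_congr rfl fun _ _ => Finset.sum_congr rfl fun _ _ =>
      Finset.sum_congr rfl fun _ _ => by ring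
  have h1 : ev4 (chrPair g z) x y u v = ∑ e, ∑ f, (((g z)⁻¹ e f : ℝ) : ℂ) *
      (ev2 (fun a b => chrLow g e a b z) x y * ev2 (fun a b => chrLow g f a b z) u v) := by
    have key : ∀ f : Fin 4 → Fin 4 → ℝ,
        ∀ T : Fin 4 → Fin 4 → Fin 4 → Fin 4 → Fin 4 → Fin 4 → ℝ,
        ev4 (fun a b c d => ∑ e, ∑ k, f e k * T e k a b c d) x y u v =
        ∑ e, ∑ k, (f e k : ℂ) * ev4 (T e k) x y u v := fun f T => by
      simp only [← ev4_mul_tensor]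
      have : ∀ S : Fin 4 → Fin 4 → Fin 4 → Fin 4 → Fin 4 → ℝ,
          ev4 (fun a b c d => ∑ e, S e a b c d) x y u v = ∑ e, ev4 (S e) x y u v := fun S => by
        simp only [Fin.sum_univ_four, ev4_add_tensor]
      rw [this]
      exact Finset.sum_congr rfl fun e _ => this _
    have h2 : chrPair g z = fun a b c d =>
      ∑ e, ∑ f, (g z)⁻¹ e f * (chrLow g e a b z * chrLow g f c d z) := rfl
    rw [h2]
    refine (key (fun e f => (g z)⁻¹ e f)
      (fun e f a b c d => chrLow g e a b z * chrLow g f c d z)).trans ?_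
    exact Finset.sum_congr rfl fun e _ => Finset.sum_congr rfl fun f _ => by
      rw [ev4_prod (fun a b => chrLow g e a b z) (fun c d => chrLow g f c d z)]
  rw [h1]
  simp only [inv_eq_frame hF hK, e]
  simp only [Fin.sum_univ_four]
  ring

/-- The curvature of a null bivector in terms of derivatives of the metric. -/
theorem ev4_riemann (hg : ∀ a b, ContDiffAt ℝ 2 (fun w => g w a b) z)
    (hs : ∀ᶠ w in 𝓝 z, ∀ a b, g w a b = g w b a)
    (hdet : (g z).det ≠ 0) (u v : Fin 4 → ℂ) :
    ev4 (riemann g z) u v u v = (1 / 2) * (ev4 (jet2 g z) u v u v - ev4 (jet2 g z) u u v v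
      - ev4 (jet2 g z) v v u u + ev4 (jet2 g z) v u u v)
      - ev4 (chrPair g z) u u v v + ev4 (chrPair g z) v u u v := by
  have h : riemann g z = fun d c a b => (1 / 2) * (jet2 g z a c d b - jet2 g z a d b c
      - jet2 g z b c d a + jet2 g z b d a c) - chrPair g z a d b c + chrPair g z b d a c := by
    funext d c a b
    exact riemann_eq_jet hg hs hdet d c a b
  have c1 : ∀ T : Fin 4 → Fin 4 → Fin 4 → Fin 4 → ℝ,
      ev4 (fun d c a b => T a c d b) u v u v = ev4 T u v u v := fun T => by
    rw [ev4_swap₂₃ (fun d a c b => T a c d b), ev4_swap₁₂ (fun a d c b => T a c d b),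
      ev4_swap₂₃ T]
  have c2 : ∀ T : Fin 4 → Fin 4 → Fin 4 → Fin 4 → ℝ,
      ev4 (fun d c a b => T a d b c) u v u v = ev4 T u u v v := fun T => by
    rw [ev4_swap₂₃ (fun d a c b => T a d b c), ev4_swap₁₂ (fun a d c b => T a d b c),
      ev4_swap₃₄ T]
  have c3 : ∀ T : Fin 4 → Fin 4 → Fin 4 → Fin 4 → ℝ,
      ev4 (fun d c a b => T b c d a) u v u v = ev4 T v v u u := fun T => by
    rw [ev4_swap₃₄ (fun d c b a => T b c d a), ev4_swap₂₃ (fun d b c a => T b c d a),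
      ev4_swap₁₂ (fun b d c a => T b c d a), ev4_swap₂₃ T]
  have c4 : ∀ T : Fin 4 → Fin 4 → Fin 4 → Fin 4 → ℝ,
      ev4 (fun d c a b => T b d a c) u v u v = ev4 T v u u v := fun T => by
    rw [ev4_swap₃₄ (fun d c b a => T b d a c), ev4_swap₂₃ (fun d b c a => T b d a c),
      ev4_swap₁₂ (fun b d c a => T b d a c), ev4_swap₃₄ T]
  rw [h]
  simp only [ev4_add_tensor, ev4_sub_tensor, ev4_mul_tensor]
  rw [c1 (jet2 g z), c2 (jet2 g z), c3 (jet2 g z), c4 (jet2 g z), c2 (chrPair g z),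
    c4 (chrPair g z)]
  simp

end Real

/-! ### Levi-Civita and Chern curvature on null bivectors -/

section Hermitian

variable {G : C2 → Matrix (Fin 2) (Fin 2) ℂ} {z : C2}

theorem contDiffAt_realMetric (hG : ∀ i j, ContDiffAt ℝ 2 (fun w => G w i j) z) (a b : Fin 4) :
    ContDiffAt ℝ 2 (fun w => realMetric G w a b) z := by
  have h : ContDiffAt ℝ 2 (fun w => ∑ i, ∑ j, G w i j * realBasis a i * conj (realBasis b j)) z :=
    ContDiffAt.sum fun i _ => ContDiffAt.sum fun j _ =>
      ((hG i j).mul contDiffAt_const).mul contDiffAt_const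
  exact contDiffAt_const.mul (Complex.reCLM.contDiff.contDiffAt.comp z h)

/-- The components `R_{i j̄ k l̄} Xⁱ Yʲ Xᵏ Yˡ` of the Chern curvature. -/
def chernForm (G : C2 → Matrix (Fin 2) (Fin 2) ℂ) (z : C2) (X Y : C2) : ℂ :=
  ∑ i, ∑ j, ∑ k, ∑ l, chernCoord G z i j k l * X i * Y j * X k * Y l

theorem dC_congr {F F' : C2 → ℂ} (h : F =ᶠ[𝓝 z] F') (x : Fin 4 → ℂ) : dC x F z = dC x F' z := by
  simp only [dC, h.fderiv_eq]

theorem dC_eventually_congr {F F' : C2 → ℂ} (h : F =ᶠ[𝓝 z] F') (x : Fin 4 → ℂ) :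
    dC x F =ᶠ[𝓝 z] dC x F' := by
  filter_upwards [h.fderiv (𝕜 := ℝ)] with w hw
  simp only [dC, hw]

theorem dC_zero (x : Fin 4 → ℂ) : dC x (fun _ => 0) = fun _ => 0 := by
  funext w
  simp [dC]

theorem hol_eq (X : C2) : hol X = X 0 • hol (Pi.single 0 1) + X 1 • hol (Pi.single 1 1) := by
  ext a; fin_cases a <;> simp [hol] <;> ring

theorem anti_eq (Y : C2) : anti Y = Y 0 • anti (Pi.single 0 1) + Y 1 • anti (Pi.single 1 1) := by
  ext a; fin_cases a <;> simp [anti] <;> ring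

/-- In dimension two, `γ` annihilating `X` means γ = k(−X₁, X₀), and likewise δ = m(−Y₁, Y₀). The
adjugate of `H` evaluated on them is km·⟨X,Y⟩. It serves to kill the mixed Christoffel term, which
need not vanish for a non-Kähler metric in general. -/
theorem sum_null_eq_zero {H : Matrix (Fin 2) (Fin 2) ℂ} {X Y γ δ : C2} (hX : X ≠ 0) (hY : Y ≠ 0)
    (hXY : pairing H X Y = 0) (hγ : X 0 * γ 0 + X 1 * γ 1 = 0) (hδ : Y 0 * δ 0 + Y 1 * δ 1 = 0) :
    H 1 1 * γ 0 * δ 0 - H 1 0 * γ 0 * δ 1 - H 0 1 * γ 1 * δ 0 + H 0 0 * γ 1 * δ 1 = 0 := by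
  have hk : ∀ {X γ : C2}, X ≠ 0 → X 0 * γ 0 + X 1 * γ 1 = 0 →
      ∃ k : ℂ, γ 0 = -k * X 1 ∧ γ 1 = k * X 0 := fun {X γ} hX hγ => by
    by_cases h0 : X 0 = 0
    · have h1 : X 1 ≠ 0 := fun h1 => hX (by ext i; fin_cases i <;> simp [h0, h1])
      refine ⟨-γ 0 / X 1, by field_simp, ?_⟩
      rw [h0] at hγ ⊢
      have : γ 1 = 0 := by simpa [h1] using hγ
      simp [this]
    · exact ⟨γ 1 / X 0, by field_simp; linear_combination hγ, by field_simp⟩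
  obtain ⟨k, a0, a1⟩ := hk hX hγ
  obtain ⟨m, b0, b1⟩ := hk hY hδ
  simp only [pairing, Fin.sum_univ_two] at hXY
  rw [a0, a1, b0, b1]
  linear_combination k * m * hXY

/-- On a null bivector `X ∧ Ȳ` the curvature of the Levi-Civita connection is, up to sign, the
curvature of the Chern connection. -/
theorem ev4_riemann_eq_chern (hG : ∀ i j, ContDiffAt ℝ 2 (fun w => G w i j) z)
    (hH : ∀ᶠ w in 𝓝 z, ∀ i j, G w j i = conj (G w i j)) (hD : hermDet (G z) ≠ 0) {X Y : C2}
    (hX : X ≠ 0) (hY : Y ≠ 0) (hXY : pairing (G z) X Y = 0) :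
    ev4 (riemann (realMetric G) z) (hol X) (anti Y) (hol X) (anti Y) = - chernForm G z X Y := by
  set g := realMetric G with hg_def
  have hHz := hH.self_of_nhds
  have hg := contDiffAt_realMetric hG
  have hg1 : ∀ a b, DifferentiableAt ℝ (fun w => g w a b) z :=
    fun a b => (hg a b).differentiableAt (by norm_num)
  have hs : ∀ᶠ w in 𝓝 z, ∀ a b, g w a b = g w b a := by
    filter_upwards [hH] with w hw a b
    exact congrFun (congrFun (realMetric_symm hw) b) a
  have hdet : (g z).det ≠ 0 := by
    rw [hg_def, realMetric_det hHz]; simpa using hD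
  -- The metric is Hermitian on a whole neighbourhood, so its (2,0) and (0,2) components vanish
  -- together with their derivatives.
  have bhh : ∀ X Y, (fun w => bil (g w) (hol X) (hol Y)) =ᶠ[𝓝 z] fun _ => 0 := fun X Y => by
    filter_upwards [hH] with w hw using bil_hol_hol hw X Y
  have baa : ∀ X Y, (fun w => bil (g w) (anti X) (anti Y)) =ᶠ[𝓝 z] fun _ => 0 := fun X Y => by
    filter_upwards [hH] with w hw using bil_anti_anti hw X Y
  have bha : ∀ X Y, (fun w => bil (g w) (hol X) (anti Y)) =ᶠ[𝓝 z] fun w => pairing (G w) X Y :=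
    fun X Y => by filter_upwards [hH] with w hw using bil_hol_anti hw X Y
  have bah : ∀ X Y, (fun w => bil (g w) (anti Y) (hol X)) =ᶠ[𝓝 z] fun w => pairing (G w) X Y :=
    fun X Y => by filter_upwards [hH] with w hw using bil_anti_hol hw X Y
  have jhh : ∀ x X Y, jet1 g z x (hol X) (hol Y) = 0 := fun x X Y => by
    rw [jet1, ← dC_bil hg1, dC_congr (bhh X Y), dC_zero]
  have jaa : ∀ x X Y, jet1 g z x (anti X) (anti Y) = 0 := fun x X Y => by
    rw [jet1, ← dC_bil hg1, dC_congr (baa X Y), dC_zero]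
  have jah : ∀ x X Y, jet1 g z x (anti Y) (hol X) = jet1 g z x (hol X) (anti Y) := fun x X Y => by
    rw [jet1, jet1, ← dC_bil hg1, ← dC_bil hg1, dC_congr (bah X Y), dC_congr (bha X Y)]
  have hsingle : ∀ k l, (fun w => pairing (G w) (Pi.single k 1) (Pi.single l 1)) =
      fun w => G w k l := fun k l => by
    funext w
    simp [pairing, Pi.single_apply]
  have jha : ∀ x k l, jet1 g z x (hol (Pi.single k 1)) (anti (Pi.single l 1)) =
      dC x (fun w => G w k l) z := fun x k l => by
    rw [jet1, ← dC_bil hg1, dC_congr (bha _ _), hsingle]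
  have j2hh : ∀ x y X Y, ev4 (jet2 g z) x y (hol X) (hol Y) = 0 := fun x y X Y => by
    rw [← dC_dC_bil hg, dC_congr (dC_eventually_congr (bhh X Y) y), dC_zero, dC_zero]
  have j2aa : ∀ x y X Y, ev4 (jet2 g z) x y (anti X) (anti Y) = 0 := fun x y X Y => by
    rw [← dC_dC_bil hg, dC_congr (dC_eventually_congr (baa X Y) y), dC_zero, dC_zero]
  have j2ha : ∀ i j k l, ev4 (jet2 g z) (hol (Pi.single i 1)) (anti (Pi.single j 1))
      (hol (Pi.single k 1)) (anti (Pi.single l 1)) =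
      dz i (dzbar j (fun w => G w k l)) z := fun i j k l => by
    rw [← dC_dC_bil hg, dC_congr (dC_eventually_congr (bha _ _) _), hsingle, dz_eq]
    congr 1
    funext w
    rw [dzbar_eq]
  have j2comm : ∀ x y u v, ev4 (jet2 g z) y x u v = ev4 (jet2 g z) x y u v := fun x y u v => by
    rw [← ev4_swap₁₂]
    congr 1
    funext a b c d
    exact jet2_comm hg b a c d
  -- the inverse metric
  set F : Fin 4 → Fin 4 → ℂ := ![hol (Pi.single 0 1), hol (Pi.single 1 1),
    anti (Pi.single 0 1), anti (Pi.single 1 1)] with hF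
  set N : Matrix (Fin 4) (Fin 4) ℂ := !![0, 0, G z 0 0, G z 0 1; 0, 0, G z 1 0, G z 1 1;
    G z 0 0, G z 1 0, 0, 0; G z 0 1, G z 1 1, 0, 0] with hN
  set D : ℂ := ((hermDet (G z) : ℝ) : ℂ) with hDdef
  have hD' : D ≠ 0 := by rw [hDdef]; exact_mod_cast hD
  have hDe := hermDet_eq hHz
  rw [← hDdef] at hDe
  set K : Matrix (Fin 4) (Fin 4) ℂ := D⁻¹ • !![0, 0, G z 1 1, -G z 1 0; 0, 0, -G z 0 1, G z 0 0;
    G z 1 1, -G z 0 1, 0, 0; -G z 1 0, G z 0 0, 0, 0] with hK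
  have hFN : ∀ A B, bil (g z) (F A) (F B) = N A B := by
    have hp : ∀ k l, pairing (G z) (Pi.single k 1) (Pi.single l 1) = G z k l :=
      fun k l => congrFun (hsingle k l) z
    intro A B
    fin_cases A <;> fin_cases B <;>
      simp [F, N, hg_def, bil_hol_hol hHz, bil_anti_anti hHz, bil_hol_anti hHz, bil_anti_hol hHz,
        hp]
  have hNK : N * K = 1 := by
    rw [hK, Matrix.mul_smul, hN]
    ext A B
    fin_cases A <;> fin_cases B <;> simp <;>
      first
      | (right; ring)
      | (field_simp; rw [hDe]; ring)
  have hinv : ∀ p q, invMetric G z p q = D⁻¹ * !![G z 1 1, -G z 1 0; -G z 0 1, G z 0 0] p q := by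
    intro p q
    have : (G z)⁻¹ = D⁻¹ • !![G z 1 1, -G z 0 1; -G z 1 0, G z 0 0] := by
      rw [Matrix.inv_def, Matrix.adjugate_fin_two, Matrix.det_fin_two, ← hDe, Ring.inverse_eq_inv']
    rw [invMetric, this]
    fin_cases p <;> fin_cases q <;> simp
  have hpair : ∀ x y u v, ev4 (chrPair g z) x y u v = D⁻¹ * (
      G z 1 1 * (chrExt g z (F 0) x y * chrExt g z (F 2) u v
        + chrExt g z (F 2) x y * chrExt g z (F 0) u v)
      - G z 1 0 * (chrExt g z (F 0) x y * chrExt g z (F 3) u v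
        + chrExt g z (F 3) x y * chrExt g z (F 0) u v)
      - G z 0 1 * (chrExt g z (F 1) x y * chrExt g z (F 2) u v
        + chrExt g z (F 2) x y * chrExt g z (F 1) u v)
      + G z 0 0 * (chrExt g z (F 1) x y * chrExt g z (F 3) u v
        + chrExt g z (F 3) x y * chrExt g z (F 1) u v)) := fun x y u v => by
    rw [ev4_chrPair hFN hNK]
    simp [Fin.sum_univ_four, K]
    ring
  -- the mixed term vanishes
  have hmixed : ev4 (chrPair g z) (anti Y) (hol X) (hol X) (anti Y) = 0 := by
    have hsym : ∀ w, chrExt g z w (hol X) (anti Y) = chrExt g z w (anti Y) (hol X) := fun w => by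
      rw [chrExt_eq, chrExt_eq, jah w X Y]; ring
    -- By the Koszul formula Γ(X; Ȳ, X) = ½(∂_Ȳ⟨X,X⟩ + ∂_X⟨X,Ȳ⟩ − ∂_X⟨Ȳ,X⟩) = 0, so the mixed
    -- symbols, as a covector in the first slot, annihilate `X`; by the same argument they
    -- annihilate `Y`.
    have hγ : X 0 * chrExt g z (F 0) (anti Y) (hol X) + X 1 * chrExt g z (F 1) (anti Y) (hol X)
        = 0 := by
      have : chrExt g z (hol X) (anti Y) (hol X) = 0 := by
        rw [chrExt_eq, jhh, jah]; ring
      rw [← this]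
      calc _ = chrExt g z (X 0 • hol (Pi.single 0 1) + X 1 • hol (Pi.single 1 1))
            (anti Y) (hol X) := by
            rw [chrExt, chrExt, chrExt, ev3_add₁, ev3_smul₁, ev3_smul₁]; rfl
        _ = _ := by rw [← hol_eq X]
    have hδ : Y 0 * chrExt g z (F 2) (anti Y) (hol X) + Y 1 * chrExt g z (F 3) (anti Y) (hol X)
        = 0 := by
      have : chrExt g z (anti Y) (anti Y) (hol X) = 0 := by
        rw [chrExt_eq, jaa, jah]; ring
      rw [← this]
      calc _ = chrExt g z (Y 0 • anti (Pi.single 0 1) + Y 1 • anti (Pi.single 1 1))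
            (anti Y) (hol X) := by
            rw [chrExt, chrExt, chrExt, ev3_add₁, ev3_smul₁, ev3_smul₁]; rfl
        _ = _ := by rw [← anti_eq Y]
    have := sum_null_eq_zero (γ := fun i => ![chrExt g z (F 0) (anti Y) (hol X),
      chrExt g z (F 1) (anti Y) (hol X)] i) (δ := fun i => ![chrExt g z (F 2) (anti Y) (hol X),
      chrExt g z (F 3) (anti Y) (hol X)] i) hX hY hXY hγ hδ
    rw [hpair]
    simp only [hsym]
    simp at this
    linear_combination 2 * D⁻¹ * this
  have hmain : ev4 (chrPair g z) (hol X) (hol X) (anti Y) (anti Y) =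
      ∑ p, ∑ q, invMetric G z p q * jet1 g z (hol X) (hol X) (anti (Pi.single q 1)) *
        jet1 g z (anti Y) (hol (Pi.single p 1)) (anti Y) := by
    rw [hpair]
    have h0 : ∀ Z, chrExt g z (hol Z) (hol X) (hol X) = 0 := fun Z => by
      rw [chrExt_eq]; simp [jhh]
    have h1 : ∀ Z, chrExt g z (anti Z) (anti Y) (anti Y) = 0 := fun Z => by
      rw [chrExt_eq]; simp [jaa]
    have h2 : ∀ Z, chrExt g z (anti Z) (hol X) (hol X) = jet1 g z (hol X) (hol X) (anti Z) :=
      fun Z => by rw [chrExt_eq, jhh, jah]; ring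
    have h3 : ∀ Z, chrExt g z (hol Z) (anti Y) (anti Y) = jet1 g z (anti Y) (hol Z) (anti Y) :=
      fun Z => by rw [chrExt_eq, jaa]; ring
    simp [F, h0, h1, h2, h3, hinv, Fin.sum_univ_two]
    ring
  -- The two surviving second derivatives coincide, leaving ∂_X∂_Ȳ⟨X,Ȳ⟩ minus the quadratic term
  -- `hmain`, which is the Chern curvature with opposite sign.
  rw [ev4_riemann hg hs hdet, hmixed, hmain, j2hh, j2aa, j2comm (hol X) (anti Y)]
  rw [chernForm]
  simp only [chernCoord, ← j2ha, dz_eq, dzbar_eq, ← jha]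
  have t1 : ev4 (jet2 g z) (hol X) (anti Y) (hol X) (anti Y) = ∑ i, ∑ j, ∑ k, ∑ l,
      ev4 (jet2 g z) (hol (Pi.single i 1)) (anti (Pi.single j 1))
      (hol (Pi.single k 1)) (anti (Pi.single l 1)) * X i * Y j * X k * Y l := by
    rw [hol_eq X, anti_eq Y]
    simp only [ev4_add₁, ev4_add₂, ev4_add₃, ev4_add₄, ev4_smul₁, ev4_smul₂, ev4_smul₃,
      ev4_smul₄, Fin.sum_univ_two]
    ring
  have t2 : ∀ q, jet1 g z (hol X) (hol X) (anti (Pi.single q 1)) = ∑ i, ∑ k,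
      jet1 g z (hol (Pi.single i 1)) (hol (Pi.single k 1)) (anti (Pi.single q 1)) * X i * X k :=
    fun q => by
      rw [hol_eq X]
      simp only [jet1, ev3_add₁, ev3_add₂, ev3_smul₁, ev3_smul₂, Fin.sum_univ_two]
      ring
  have t3 : ∀ p, jet1 g z (anti Y) (hol (Pi.single p 1)) (anti Y) = ∑ j, ∑ l,
      jet1 g z (anti (Pi.single j 1)) (hol (Pi.single p 1)) (anti (Pi.single l 1)) * Y j * Y l :=
    fun p => by
      rw [anti_eq Y]
      simp only [jet1, ev3_add₁, ev3_add₃, ev3_smul₁, ev3_smul₃, Fin.sum_univ_two]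
      ring
  rw [t1]
  simp only [t2, t3]
  simp only [Fin.sum_univ_two]
  ring

end Hermitian

/-! ### Polarization -/

section Polarization

/-- Replacing `t` by `r * t` with r = 0, ±1, ±2 separates the total degrees; the values t = 1, i, 1
+ i then separate the bidegrees within each degree. -/
theorem coeff_eq_zero {S : Fin 3 → Fin 3 → ℂ}
    (h : ∀ t : ℂ, ∑ a, ∑ b, S a b * t ^ (a : ℕ) * conj t ^ (b : ℕ) = 0) (a b : Fin 3) :
    S a b = 0 := by
  have h' : ∀ (r : ℤ) (t : ℂ), S 0 0 + (S 1 0 * t + S 0 1 * conj t) * r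
      + (S 2 0 * t ^ 2 + S 1 1 * t * conj t + S 0 2 * conj t ^ 2) * r ^ 2
      + (S 2 1 * t ^ 2 * conj t + S 1 2 * t * conj t ^ 2) * r ^ 3
      + S 2 2 * t ^ 2 * conj t ^ 2 * r ^ 4 = 0 := fun r t => by
    have := h (r * t)
    simp [Fin.sum_univ_three] at this
    linear_combination this
  have k0 := fun t => h' 0 t
  have k1 := fun t => h' 1 t
  have k2 := fun t => h' (-1) t
  have k3 := fun t => h' 2 t
  have k4 := fun t => h' (-2) t
  push_cast at k0 k1 k2 k3 k4
  have n0 : S 0 0 = 0 := by linear_combination k0 0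
  have n1 : ∀ t : ℂ, S 1 0 * t + S 0 1 * conj t = 0 := fun t => by
    linear_combination (2 / 3) * (k1 t - k2 t) - (1 / 12) * (k3 t - k4 t)
  have n3 : ∀ t : ℂ, S 2 1 * t ^ 2 * conj t + S 1 2 * t * conj t ^ 2 = 0 := fun t => by
    linear_combination (-1 / 6) * (k1 t - k2 t) + (1 / 12) * (k3 t - k4 t)
  have n2 : ∀ t : ℂ, S 2 0 * t ^ 2 + S 1 1 * t * conj t + S 0 2 * conj t ^ 2 = 0 := fun t => by
    linear_combination (2 / 3) * (k1 t + k2 t) - (1 / 24) * (k3 t + k4 t) - (5 / 4) * n0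
  have n4 : S 2 2 = 0 := by
    have d1 := k1 1
    have d2 := k2 1
    have d3 := k3 1
    have d4 := k4 1
    simp only [map_one] at d1 d2 d3 d4
    linear_combination (1 / 24) * (d3 + d4) - (1 / 6) * (d1 + d2) + (1 / 4) * n0
  have I2 := Complex.I_sq
  have a1 := n1 1
  have a2 := n1 Complex.I
  have b1 := n3 1
  have b2 := n3 Complex.I
  have c1 := n2 1
  have c2 := n2 Complex.I
  have c3 := n2 (1 + Complex.I)
  simp only [map_one, map_add, Complex.conj_I] at a1 a2 b1 b2 c1 c2 c3
  fin_cases a <;> fin_cases b <;> simp only [Fin.zero_eta, Fin.mk_one, Fin.reduceFinMk]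
  · exact n0
  · linear_combination (1 / 2) * a1 + (1 / 2) * Complex.I * a2
      - (1 / 2) * (S 1 0 - S 0 1) * I2
  · grind
  · linear_combination (1 / 2) * a1 - (1 / 2) * Complex.I * a2
      + (1 / 2) * (S 1 0 - S 0 1) * I2
  · grind
  · grind
  · grind
  · grind
  · exact n4

/-- The vectors (1, t) already determine every coefficient of a form of bidegree (2,2). `S a b`
collects the entries of `T` with `a` holomorphic and `b` antiholomorphic indices equal to 1. -/
theorem polarization {T : Fin 2 → Fin 2 → Fin 2 → Fin 2 → ℂ}
    (h : ∀ X : C2, ∑ i, ∑ j, ∑ k, ∑ l, T i j k l * X i * conj (X j) * X k * conj (X l) = 0)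
    (X Y : C2) : ∑ i, ∑ j, ∑ k, ∑ l, T i j k l * X i * Y j * X k * Y l = 0 := by
  set S : Fin 3 → Fin 3 → ℂ :=
    ![![T 0 0 0 0, T 0 0 0 1 + T 0 1 0 0, T 0 1 0 1],
      ![T 0 0 1 0 + T 1 0 0 0, T 0 0 1 1 + T 0 1 1 0 + T 1 0 0 1 + T 1 1 0 0,
        T 0 1 1 1 + T 1 1 0 1],
      ![T 1 0 1 0, T 1 0 1 1 + T 1 1 1 0, T 1 1 1 1]] with hS
  have hS0 := coeff_eq_zero (S := S) fun t => by
    have := h ![1, t]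
    simp [Fin.sum_univ_two] at this
    simp [S, Fin.sum_univ_three]
    linear_combination this
  have s00 := hS0 0 0
  have s01 := hS0 0 1
  have s02 := hS0 0 2
  have s10 := hS0 1 0
  have s11 := hS0 1 1
  have s12 := hS0 1 2
  have s20 := hS0 2 0
  have s21 := hS0 2 1
  have s22 := hS0 2 2
  simp [S] at s00 s01 s02 s10 s11 s12 s20 s21 s22
  simp only [Fin.sum_univ_two]
  linear_combination s00 * X 0 ^ 2 * Y 0 ^ 2 + s01 * X 0 ^ 2 * Y 0 * Y 1 + s02 * X 0 ^ 2 * Y 1 ^ 2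
    + s10 * X 0 * X 1 * Y 0 ^ 2 + s11 * X 0 * X 1 * Y 0 * Y 1 + s12 * X 0 * X 1 * Y 1 ^ 2
    + s20 * X 1 ^ 2 * Y 0 ^ 2 + s21 * X 1 ^ 2 * Y 0 * Y 1 + s22 * X 1 ^ 2 * Y 1 ^ 2

/-- If the mixed curvature is constant on all `(1,0)`-vectors at a point, then the Chern curvature
vanishes on `X ∧ Ȳ` for `⟨X, Ȳ⟩ = 0`. -/
theorem chernForm_eq_zero {G : C2 → Matrix (Fin 2) (Fin 2) ℂ} {z : C2} {α β f : ℂ} (hβ : β ≠ 0)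
    (h : ∀ X : C2, α * pairing (G z) X (conj X) * pairing (chernRicciCoord G z) X (conj X)
      + β * chernForm G z X (conj X) = f * pairing (G z) X (conj X) ^ 2)
    {X Y : C2} (hXY : pairing (G z) X Y = 0) : chernForm G z X Y = 0 := by
  have key : ∀ X Y : C2, ∑ i, ∑ j, ∑ k, ∑ l, (α * chernRicciCoord G z i j * G z k l
      + β * chernCoord G z i j k l - f * G z i j * G z k l) * X i * Y j * X k * Y l =
      α * pairing (G z) X Y * pairing (chernRicciCoord G z) X Y
      + β * chernForm G z X Y - f * pairing (G z) X Y ^ 2 := fun X Y => by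
    simp only [pairing, chernForm, Fin.sum_univ_two]
    ring
  have h2 := polarization (T := fun i j k l => α * chernRicciCoord G z i j * G z k l
      + β * chernCoord G z i j k l - f * G z i j * G z k l) (fun X => by
    have h3 := key X (conj X)
    rw [h X, sub_self] at h3
    exact h3) X Y
  -- Both other terms contain the factor ⟨X,Y⟩, so only β times the Chern curvature is left.
  rw [key, hXY] at h2
  simpa [hβ] using h2

end Polarization

namespace HermitianMetric

/-! ### Hermitian metrics in a chart -/

variable {M : Type*} [TopologicalSpace M] [ChartedSpace C2 M] (g : HermitianMetric M)

theorem coeff_conj (φ : OpenPartialHomeomorph M C2) (z : C2) (i j : Fin 2) :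
    g.coeff φ z j i = conj (g.coeff φ z i j) :=
  g.conj_symm _ _ _

theorem form_mfderiv_symm (φ : OpenPartialHomeomorph M C2) (z c d : C2) :
    g.form (φ.symm z) (mfderiv 𝓘(ℂ, C2) 𝓘(ℂ, C2) φ.symm z c)
      (mfderiv 𝓘(ℂ, C2) 𝓘(ℂ, C2) φ.symm z d) = pairing (g.coeff φ z) c (conj d) := by
  have hc : ∀ c : C2, (mfderiv 𝓘(ℂ, C2) 𝓘(ℂ, C2) φ.symm z c :
      TangentSpace 𝓘(ℂ, C2) (φ.symm z)) = c 0 • coordVec φ z 0 + c 1 • coordVec φ z 1 := by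
    intro c
    have : c = c 0 • (Pi.single 0 1 : C2) + c 1 • (Pi.single 1 1 : C2) := by
      ext i; fin_cases i <;> simp
    conv_lhs => rw [this]
    exact (map_add _ _ _).trans (congrArg₂ _ (map_smul _ _ _) (map_smul _ _ _))
  rw [hc c, hc d]
  simp only [map_add, LinearMap.add_apply, map_smul, LinearMap.map_smulₛₗ, LinearMap.smul_apply,
    smul_eq_mul, pairing, coeff, Fin.sum_univ_two, Pi.conj_apply]
  ring

theorem contDiffAt_coeff (x : M) (i j : Fin 2) :
    ContDiffAt ℝ 2 (fun w => g.coeff (chartAt C2 x) w i j) (chartAt C2 x x) :=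
  contDiffAt_infty.1 ((g.smooth _ (chart_mem_atlas C2 x) i j).contDiffAt
    ((chartAt C2 x).open_target.mem_nhds (mem_chart_target C2 x))) 2

variable [IsManifold 𝓘(ℂ, C2) ω M]

theorem mdifferentiable_chart (x : M) :
    (chartAt C2 x).MDifferentiable 𝓘(ℂ, C2) 𝓘(ℂ, C2) :=
  haveI : IsManifold 𝓘(ℂ, C2) 1 M := IsManifold.of_le (n := ω) le_top
  _root_.mdifferentiable_chart x

/-- Every vector of `ℂ²` is the coordinate vector of a tangent vector at `x`. -/
theorem exists_comp_eq (x : M) (c : C2) : ∃ X : TangentSpace 𝓘(ℂ, C2) x, comp x X = c ∧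
    g.form x X X = pairing (g.coeff (chartAt C2 x) (chartAt C2 x x)) c (conj c) := by
  set φ := chartAt C2 x with hφ
  have hz : φ x ∈ φ.target := mem_chart_target C2 x
  -- The vector is built in the tangent space at φ⁻¹(φ(x)); generalizing this point allows transport
  -- to `x`.
  have key : ∀ y, φ.symm (φ x) = y → ∃ X : TangentSpace 𝓘(ℂ, C2) y,
      mfderiv 𝓘(ℂ, C2) 𝓘(ℂ, C2) φ y X = c ∧
      g.form y X X = pairing (g.coeff φ (φ x)) c (conj c) := by
    rintro _ rfl
    refine ⟨mfderiv 𝓘(ℂ, C2) 𝓘(ℂ, C2) φ.symm (φ x) c, ?_, g.form_mfderiv_symm φ _ c c⟩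
    have := (mdifferentiable_chart x).comp_symm_deriv hz
    exact congrArg (fun L => L c) this
  exact key x (φ.left_inv (mem_chart_source C2 x))

theorem pairing_coeff_pos (x : M) {c : C2} (hc : c ≠ 0) :
    0 < (pairing (g.coeff (chartAt C2 x) (chartAt C2 x x)) c (conj c)).re := by
  obtain ⟨X, h1, h2⟩ := g.exists_comp_eq x c
  rw [← h2]
  refine g.pos x X fun h0 => hc ?_
  rw [← h1, h0]
  exact map_zero _

theorem coeff_pos (x : M) : 0 < (g.coeff (chartAt C2 x) (chartAt C2 x x) 0 0).re ∧
    0 < hermDet (g.coeff (chartAt C2 x) (chartAt C2 x x)) := by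
  set φ := chartAt C2 x
  have hH := g.coeff_conj φ (φ x)
  have h1 : 0 < (g.coeff φ (φ x) 0 0).re := by
    have := g.pairing_coeff_pos x (c := ![1, 0]) (fun h => by simpa using congrFun h 0)
    simpa [pairing, Fin.sum_univ_two] using this
  refine ⟨h1, ?_⟩
  obtain ⟨k0, k1, k2, k3⟩ := hermitian_components (G := g.coeff φ) hH
  have hne : g.coeff φ (φ x) 0 0 ≠ 0 := fun h => by rw [h] at h1; simp at h1
  -- This vector is orthogonal to ∂/∂z⁰ and has squared length g₀₀ · det, which forces the
  -- determinant to be positive.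
  have h2 := g.pairing_coeff_pos x (c := ![-g.coeff φ (φ x) 1 0, g.coeff φ (φ x) 0 0])
    (fun h => hne (by simpa using congrFun h 1))
  have h3 : pairing (g.coeff φ (φ x)) ![-g.coeff φ (φ x) 1 0, g.coeff φ (φ x) 0 0]
      (conj ![-g.coeff φ (φ x) 1 0, g.coeff φ (φ x) 0 0]) =
      (((g.coeff φ (φ x) 0 0).re * hermDet (g.coeff φ (φ x)) : ℝ) : ℂ) := by
    rw [Complex.ofReal_mul, hermDet_eq hH, ← k0]
    simp [pairing, Fin.sum_univ_two, ← hH 1 0, ← hH 0 0]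
    ring
  rw [h3, Complex.ofReal_re] at h2
  exact (mul_pos_iff_of_pos_left h1).1 h2

end HermitianMetric
end HermitianSurface
end

/-! ### Conclusion at a point -/

theorem mainTheorem6 {M : Type*} [TopologicalSpace M] [ChartedSpace HermitianSurface.C2 M]
    [IsManifold 𝓘(ℂ, HermitianSurface.C2) ω M]
    (g : HermitianSurface.HermitianMetric M) (α β : ℝ) (hβ : β ≠ 0) (f : M → ℝ)
    (hf : ∀ (x : M) (X : TangentSpace 𝓘(ℂ, HermitianSurface.C2) x), X ≠ 0 →
      g.mixedCurvature α β x X = (f x : ℂ)) :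
    g.IsSelfDual := by
  open HermitianSurface HermitianMetric in
  intro x v₁ v₂ v₃ v₄
  set φ := chartAt C2 x with hφ
  set G := g.coeff φ with hG
  set z := φ x with hz
  have hH : ∀ w i j, G w j i = conj (G w i j) := g.coeff_conj φ
  have hH' : ∀ᶠ w in nhds z, ∀ i j, G w j i = conj (G w i j) := Filter.Eventually.of_forall hH
  obtain ⟨hp, hD⟩ := g.coeff_pos x
  have hG2 : ∀ i j, ContDiffAt ℝ 2 (fun w => G w i j) z := g.contDiffAt_coeff x
  have hR : IsCurvature (riemann (realMetric G) z) := by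
    refine isCurvature_riemann (contDiffAt_realMetric hG2) ?_ ?_
    · exact Filter.Eventually.of_forall fun w a b =>
        congrFun (congrFun (realMetric_symm (hH w)) b) a
    · rw [realMetric_det (hH z)]
      have : hermDet (G z) ≠ 0 := hD.ne'
      simpa using this
  -- With denominators cleared the identity also holds at the zero vector, hence is polynomial on
  -- all of ℂ² and can be polarized.
  have hmix : ∀ X : C2, (α : ℂ) * pairing (G z) X (conj X) *
      pairing (chernRicciCoord G z) X (conj X) + β * chernForm G z X (conj X) =
      f x * pairing (G z) X (conj X) ^ 2 := by
    intro c
    by_cases hc : c = 0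
    · subst hc
      simp [pairing, chernForm]
    · obtain ⟨X, h1, h2⟩ := g.exists_comp_eq x c
      have hX : X ≠ 0 := fun h0 => hc (by rw [← h1, h0]; exact map_zero _)
      have h3 := hf x X hX
      have hpos : pairing (G z) c (conj c) ≠ 0 := fun h0 => by
        have := g.pairing_coeff_pos x hc
        rw [show pairing (g.coeff (chartAt C2 x) (chartAt C2 x x)) c (conj c) = 0 from h0] at this
        simp at this
      have h4 : g.chernRicci x X X = pairing (chernRicciCoord G z) c (conj c) := by
        rw [← h1]; rfl
      have h5 : g.chern x X X X X = chernForm G z c (conj c) := by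
        rw [← h1]; rfl
      have h6 : g.form x X X = pairing (G z) c (conj c) := h2
      rw [mixedCurvature, holSec, h4, h5, h6] at h3
      rw [← h3]
      field_simp
  have hnull : ∀ X Y : C2, pairing (G z) X Y = 0 →
      ev4 (riemann (realMetric G) z) (hol X) (anti Y) (hol X) (anti Y) = 0 := by
    intro X Y hXY
    by_cases hX : X = 0
    · have : hol X = (0 : ℂ) • hol X := by rw [← hol_smul, hX, smul_zero]
      rw [this, ev4_smul₁, zero_mul]
    by_cases hY : Y = 0
    · have : anti Y = (0 : ℂ) • anti Y := by rw [← anti_smul, hY, smul_zero]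
      rw [this, ev4_smul₂, zero_mul]
    rw [ev4_riemann_eq_chern hG2 hH' hD.ne' hX hY hXY,
      chernForm_eq_zero (by exact_mod_cast hβ) hmix hXY, neg_zero]
  have hW := weylMinusCoord_eq_zero (hH z) hp hD hR hnull
  rw [weylMinus]
  refine Finset.sum_eq_zero fun a _ => Finset.sum_eq_zero fun b _ => Finset.sum_eq_zero fun c _ =>
    Finset.sum_eq_zero fun d _ => ?_
  have := hW a b c d
  rw [show weylMinusCoord (realMetric (g.coeff (chartAt C2 x))) (chartAt C2 x x) a b c d = 0
    from this]
  ring
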